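/- Let $H$ be an infinite-dimensional separable complex Hilbert space, and let $K(H)$ be the Banach space of compact linear operators on $H$ with the operator norm. Then $K(H)$ is primary: whenever $Y$ and $Z$ are complex Banach spaces such that $K(H)$ is isomorphic (linearly homeomorphic) to $Y\oplus Z$, then $K(H)$ is isomorphic to $Y$ or $K(H)$ is isomorphic to $Z$. -/

import Mathlib

universe u v w

/-- The space `K(H)` of compact (bounded linear) operators on `H`, as a subspace of the bounded
operators `H →L[ℂ] H`; it carries the operator norm. -/
abbrev CompactOperators (H : Type*) [NormedAddCommGroup H] [NormedSpace ℂ H] :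
    Submodule ℂ (H →L[ℂ] H) :=
  compactOperator (RingHom.id ℂ) H H

/-- `K(H)` is norm closed in the bounded operators, so it is a Banach space. -/
instance CompactOperators.instCompleteSpace (H : Type*) [NormedAddCommGroup H] [NormedSpace ℂ H]
    [CompleteSpace H] : CompleteSpace (CompactOperators H) :=
  (isClosed_setOfPred_isCompactOperator (σ₁₂ := RingHom.id ℂ) (M₁ := H) (M₂ := H)).completeSpace_coe

/-- A complex Banach space `X` is primary if, whenever `X` is isomorphic (linearly homeomorphic) to
a direct sum `Y ⊕ Z` of Banach spaces, it is isomorphic to `Y` or to `Z`. -/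
def IsPrimary (X : Type u) [NormedAddCommGroup X] [NormedSpace ℂ X]
    [CompleteSpace X] : Prop :=
  ∀ (Y : Type v) [NormedAddCommGroup Y] [NormedSpace ℂ Y] [CompleteSpace Y]
    (Z : Type w) [NormedAddCommGroup Z] [NormedSpace ℂ Z] [CompleteSpace Z],
    Nonempty (X ≃L[ℂ] Y × Z) → Nonempty (X ≃L[ℂ] Y) ∨ Nonempty (X ≃L[ℂ] Z)

open Filter Topology InnerProductSpace

open scoped ZeroAtInfty

set_option maxSynthPendingDepth 3

/-! The proof is Pełczyński's decomposition method fed by a factorization theorem. Write X = K(H).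
Operators that are block diagonal along countably many orthogonal copies of H form a complemented
c₀-sum of copies of X inside X. If X ≅ Y ⊕ Z, shifting Y-coordinates gives c₀(X) ≅ Y ⊕ c₀(X), hence
X ≅ Y ⊕ X; in particular X ≅ X ⊕ X. If moreover X is complemented in Y, say Y ≅ X ⊕ W, then X ≅ Y ⊕
X ≅ X ⊕ X ⊕ W ≅ X ⊕ W ≅ Y. So it suffices that for every bounded P on X the identity factors through
P or 1 - P (`identity_factors`).

By `exists_compression_near_scalar` there are J, Q with QJ = 1 and QPJ close to a scalar α. One of
α, 1 - α has modulus at least 1/2, so a Neumann series inverts the compression of P or of 1 - P.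

The scalar comes from the array ⟨e_k, P(e_i ⊗ e_j) e_l⟩, square-summable in each index. Limits along
a free ultrafilter and a greedy choice of row and column indices make it nearly a Schur multiplier
with value α on and above the diagonal and β below (`exists_almost_triangular`), with errors small
enough to sum. Since P is bounded while triangular truncation is not, as Haar-type matrices witness
(`eq_of_triangular_multiplier_bound`), α = β. -/

/-! ### Almost diagonal subarrays via a free ultrafilter -/

theorem tendsto_cofinite_zero_of_sum_norm_sq_le {ι : Type*} {E : Type*} [NormedAddCommGroup E]
    {f : ι → E} {C : ℝ} (h : ∀ s : Finset ι, ∑ i ∈ s, ‖f i‖ ^ 2 ≤ C) :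
    Tendsto f cofinite (𝓝 0) := by
  have hs : Summable fun i => ‖f i‖ ^ 2 := summable_of_sum_le (fun _ => by positivity) h
  have h2 := (Real.continuous_sqrt.tendsto 0).comp hs.tendsto_cofinite_zero
  simp only [Real.sqrt_zero] at h2
  refine tendsto_zero_iff_norm_tendsto_zero.2 (h2.congr fun i => ?_)
  simp

theorem exists_tendsto_hyperfilter {f : ℕ → ℂ} {C : ℝ} (h : ∀ n, ‖f n‖ ≤ C) :
    ∃ z, Tendsto f (hyperfilter ℕ) (𝓝 z) := by
  obtain ⟨z, -, hz⟩ := (isCompact_closedBall (0 : ℂ) C).ultrafilter_le_nhds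
    ((hyperfilter ℕ).map f) (by
      simp only [Ultrafilter.coe_map, le_principal_iff, mem_map]
      exact Eventually.of_forall fun n => by simpa using h n)
  exact ⟨z, hz⟩

theorem norm_le_sqrt_of_sum_norm_sq_le {ι : Type*} {f : ι → ℂ} {C : ℝ}
    (h : ∀ s : Finset ι, ∑ i ∈ s, ‖f i‖ ^ 2 ≤ C) (i : ι) : ‖f i‖ ≤ √C := by
  have := h {i}
  rw [Finset.sum_singleton] at this
  exact Real.le_sqrt_of_sq_le this

/-- Finite square-sum bounds pass to entrywise limits, so rows and columns of the limit matrix are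
again square-summable and vanish at infinity. Along an ultrafilter all bounded sequences converge at
once, which replaces diagonal subsequence arguments. -/
theorem exists_limit_matrix {g : ℕ → ℕ → ℕ → ℂ} {C : ℝ}
    (h1 : ∀ k j, ∀ s : Finset ℕ, ∑ i ∈ s, ‖g i k j‖ ^ 2 ≤ C)
    (h2 : ∀ i j, ∀ s : Finset ℕ, ∑ k ∈ s, ‖g i k j‖ ^ 2 ≤ C) :
    ∃ (A : ℕ → ℕ → ℂ) (α : ℂ), (∀ i k, Tendsto (g i k) (hyperfilter ℕ) (𝓝 (A i k))) ∧
      (∀ k, Tendsto (fun i => A i k) cofinite (𝓝 0)) ∧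
      (∀ i, Tendsto (fun k => A i k) cofinite (𝓝 0)) ∧
      Tendsto (fun i => A i i) (hyperfilter ℕ) (𝓝 α) := by
  have hA : ∀ i k, ∃ z, Tendsto (g i k) (hyperfilter ℕ) (𝓝 z) := fun i k =>
    exists_tendsto_hyperfilter fun j => norm_le_sqrt_of_sum_norm_sq_le (h1 k j) i
  choose A hA using hA
  have hA1 : ∀ k, ∀ s : Finset ℕ, ∑ i ∈ s, ‖A i k‖ ^ 2 ≤ C := fun k s =>
    le_of_tendsto (tendsto_finsetSum s fun i _ => ((hA i k).norm.pow 2))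
      (Eventually.of_forall fun j => h1 k j s)
  have hA2 : ∀ i, ∀ s : Finset ℕ, ∑ k ∈ s, ‖A i k‖ ^ 2 ≤ C := fun i s =>
    le_of_tendsto (tendsto_finsetSum s fun k _ => ((hA i k).norm.pow 2))
      (Eventually.of_forall fun j => h2 i j s)
  obtain ⟨α, hα⟩ := exists_tendsto_hyperfilter (f := fun i => A i i)
    fun i => norm_le_sqrt_of_sum_norm_sq_le (hA1 i) i
  exact ⟨A, α, hA, fun k => tendsto_cofinite_zero_of_sum_norm_sq_le (hA1 k),
    fun i => tendsto_cofinite_zero_of_sum_norm_sq_le (hA2 i), hα⟩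

/-- Greedy selection: sets in a free ultrafilter are infinite, so each new index can avoid the
finite set `s` of earlier choices. -/
theorem exists_seq_of_eventually_hyperfilter (Q : Finset ℕ → ℕ → ℕ → Prop)
    (h : ∀ s n, ∀ᶠ q in hyperfilter ℕ, Q s n q) :
    ∃ p : ℕ → ℕ, Function.Injective p ∧
      ∀ n, ∃ s : Finset ℕ, (∀ m < n, p m ∈ s) ∧ Q s n (p n) := by
  have h' : ∀ s : Finset ℕ, ∀ n, ∃ q, q ∉ s ∧ Q s n q := fun s n => by
    have h1 : ∀ᶠ q in (hyperfilter ℕ : Filter ℕ), q ∉ s := by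
      refine hyperfilter_le_cofinite ?_
      have : {q : ℕ | q ∉ s} = (s : Set ℕ)ᶜ := by ext; simp
      rw [this]
      exact s.finite_toSet.compl_mem_cofinite
    exact (h1.and (h s n)).exists
  choose q hq1 hq2 using h'
  let S : ℕ → Finset ℕ := fun n => Nat.rec ∅ (fun n s => insert (q s n) s) n
  have hS : ∀ n, S (n + 1) = insert (q (S n) n) (S n) := fun n => rfl
  have hmem : ∀ n, ∀ m < n, q (S m) m ∈ S n := by
    intro n
    induction n with
    | zero => intro m hm; omega
    | succ n ih =>
      intro m hm
      rw [hS, Finset.mem_insert]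
      rcases Nat.lt_succ_iff_lt_or_eq.1 hm with h | h
      · exact Or.inr (ih m h)
      · exact Or.inl (by rw [h])
  refine ⟨fun n => q (S n) n, ?_, fun n => ⟨S n, hmem n, hq2 _ _⟩⟩
  have key : ∀ m n, m < n → q (S m) m ≠ q (S n) n := fun m n hmn he =>
    hq1 (S n) n (he ▸ hmem n m hmn)
  intro m n hmn
  by_contra hne
  rcases lt_or_gt_of_ne hne with h | h
  · exact key m n h hmn
  · exact key n m h hmn.symm

theorem eventually_hyperfilter_norm_le {E : Type*} [NormedAddCommGroup E] {f : ℕ → E}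
    (h : Tendsto f cofinite (𝓝 0)) {ε : ℝ} (hε : 0 < ε) :
    ∀ᶠ q in hyperfilter ℕ, ‖f q‖ ≤ ε := by
  have := (h.mono_left hyperfilter_le_cofinite).norm.eventually_le_const (u := ε) (by simpa using hε)
  exact this

theorem eventually_norm_sub_le {E : Type*} [NormedAddCommGroup E] {l : Filter ℕ} {f : ℕ → E} {a : E}
    (h : Tendsto f l (𝓝 a)) {ε : ℝ} (hε : 0 < ε) :
    ∀ᶠ q in l, ‖f q - a‖ ≤ ε := by
  have h' : Tendsto (fun q => f q - a) l (𝓝 0) := by simpa using h.sub_const a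
  exact h'.norm.eventually_le_const (u := ε) (by simpa using hε)

/-- A four-index array that is square-summable in each index admits a sequence of indices along
which it is almost diagonal. -/
theorem exists_almost_diagonal_seq {t : ℕ → ℕ → ℕ → ℕ → ℂ} {C : ℝ}
    (h1 : ∀ j k l, ∀ s : Finset ℕ, ∑ i ∈ s, ‖t i j k l‖ ^ 2 ≤ C)
    (h2 : ∀ i k l, ∀ s : Finset ℕ, ∑ j ∈ s, ‖t i j k l‖ ^ 2 ≤ C)
    (h3 : ∀ i j l, ∀ s : Finset ℕ, ∑ k ∈ s, ‖t i j k l‖ ^ 2 ≤ C)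
    (h4 : ∀ i j k, ∀ s : Finset ℕ, ∑ l ∈ s, ‖t i j k l‖ ^ 2 ≤ C)
    {ε : ℕ → ℝ} (hε : ∀ n, 0 < ε n) :
    ∃ (p : ℕ → ℕ) (α β : ℂ), Function.Injective p ∧
      (∀ n, ∀ i < n, ∀ j < n, ∀ k < n,
        ‖t (p n) (p i) (p j) (p k)‖ ≤ ε n ∧ ‖t (p i) (p n) (p j) (p k)‖ ≤ ε n ∧
        ‖t (p i) (p j) (p n) (p k)‖ ≤ ε n ∧ ‖t (p i) (p j) (p k) (p n)‖ ≤ ε n) ∧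
      (∀ n, ∀ i < n, ∀ k < n,
        ‖t (p i) (p n) (p k) (p n) - if i = k then α else 0‖ ≤ ε n + ε (max i k)) ∧
      (∀ n, ∀ j < n, ∀ l < n,
        ‖t (p n) (p j) (p n) (p l) - if j = l then β else 0‖ ≤ ε n + ε (max j l)) := by
  -- Entries whose largest index occurs twice need not be small. Repeated in the second and fourth
  -- places it leads to the limits `A`, in the first and third to `B`; these matrices vanish along
  -- rows and columns and have diagonal limits α and β.
  obtain ⟨A, α, hA, hA1, hA2, hα⟩ := exists_limit_matrix (g := fun i k j => t i j k j) (C := C)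
    (fun k j s => h1 j k j s) (fun i j s => h3 i j j s)
  obtain ⟨B, β, hB, hB1, hB2, hβ⟩ := exists_limit_matrix (g := fun j l i => t i j i l) (C := C)
    (fun l i s => h2 i i l s) (fun j i s => h4 i j i s)
  obtain ⟨p, hp, hQ⟩ := exists_seq_of_eventually_hyperfilter (fun s n q =>
    (∀ i ∈ s, ∀ j ∈ s, ∀ k ∈ s, ‖t q i j k‖ ≤ ε n ∧ ‖t i q j k‖ ≤ ε n ∧
        ‖t i j q k‖ ≤ ε n ∧ ‖t i j k q‖ ≤ ε n) ∧
    (∀ i ∈ s, ∀ k ∈ s, ‖t i q k q - A i k‖ ≤ ε n ∧ ‖t q i q k - B i k‖ ≤ ε n) ∧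
    (∀ i ∈ s, ‖A i q‖ ≤ ε n ∧ ‖A q i‖ ≤ ε n ∧ ‖B i q‖ ≤ ε n ∧ ‖B q i‖ ≤ ε n) ∧
    ‖A q q - α‖ ≤ ε n ∧ ‖B q q - β‖ ≤ ε n) (by
      intro s n
      have hn := hε n
      refine Eventually.and ?_ (Eventually.and ?_ (Eventually.and ?_ (Eventually.and ?_ ?_)))
      · simp only [Filter.eventually_all_finset]
        intro i _ j _ k _
        exact (eventually_hyperfilter_norm_le
            (tendsto_cofinite_zero_of_sum_norm_sq_le (h1 i j k)) hn).and
          ((eventually_hyperfilter_norm_le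
            (tendsto_cofinite_zero_of_sum_norm_sq_le (h2 i j k)) hn).and
          ((eventually_hyperfilter_norm_le
            (tendsto_cofinite_zero_of_sum_norm_sq_le (h3 i j k)) hn).and
          (eventually_hyperfilter_norm_le
            (tendsto_cofinite_zero_of_sum_norm_sq_le (h4 i j k)) hn)))
      · simp only [Filter.eventually_all_finset]
        intro i _ k _
        exact (eventually_norm_sub_le (hA i k) hn).and (eventually_norm_sub_le (hB i k) hn)
      · simp only [Filter.eventually_all_finset]
        intro i _
        exact (eventually_hyperfilter_norm_le (hA2 i) hn).and
          ((eventually_hyperfilter_norm_le (hA1 i) hn).and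
          ((eventually_hyperfilter_norm_le (hB2 i) hn).and
          (eventually_hyperfilter_norm_le (hB1 i) hn)))
      · exact eventually_norm_sub_le hα hn
      · exact eventually_norm_sub_le hβ hn)
  choose s hs hQ using hQ
  have hAd : ∀ i k, ‖A (p i) (p k) - if i = k then α else 0‖ ≤ ε (max i k) := fun i k => by
    rcases lt_trichotomy i k with h | h | h
    · rw [if_neg h.ne, sub_zero, max_eq_right h.le]
      exact ((hQ k).2.2.1 _ (hs k i h)).1
    · subst h
      rw [if_pos rfl, max_self]
      exact (hQ i).2.2.2.1
    · rw [if_neg h.ne', sub_zero, max_eq_left h.le]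
      exact ((hQ i).2.2.1 _ (hs i k h)).2.1
  have hBd : ∀ i k, ‖B (p i) (p k) - if i = k then β else 0‖ ≤ ε (max i k) := fun i k => by
    rcases lt_trichotomy i k with h | h | h
    · rw [if_neg h.ne, sub_zero, max_eq_right h.le]
      exact ((hQ k).2.2.1 _ (hs k i h)).2.2.1
    · subst h
      rw [if_pos rfl, max_self]
      exact (hQ i).2.2.2.2
    · rw [if_neg h.ne', sub_zero, max_eq_left h.le]
      exact ((hQ i).2.2.1 _ (hs i k h)).2.2.2
  refine ⟨p, α, β, hp, fun n i hi j hj k hk =>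
    (hQ n).1 _ (hs n i hi) _ (hs n j hj) _ (hs n k hk), fun n i hi k hk => ?_,
    fun n i hi k hk => ?_⟩
  · have := ((hQ n).2.1 _ (hs n i hi) _ (hs n k hk)).1
    calc _ = ‖(t (p i) (p n) (p k) (p n) - A (p i) (p k)) +
          (A (p i) (p k) - if i = k then α else 0)‖ := by congr 1; ring
      _ ≤ _ := (norm_add_le _ _).trans (add_le_add this (hAd i k))
  · have := ((hQ n).2.1 _ (hs n i hi) _ (hs n k hk)).2
    calc _ = ‖(t (p n) (p i) (p n) (p k) - B (p i) (p k)) +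
          (B (p i) (p k) - if i = k then β else 0)‖ := by congr 1; ring
      _ ≤ _ := (norm_add_le _ _).trans (add_le_add this (hBd i k))

/-! ### Geometric error weights and the triangular pattern -/

/-- The geometric weights `2⁻¹, 2⁻², …`. -/
noncomputable def geomWeight (n : ℕ) : ℝ := (1 / 2) ^ (n + 1)

theorem geomWeight_pos (n : ℕ) : 0 < geomWeight n := by unfold geomWeight; positivity

theorem geomWeight_le_one (n : ℕ) : geomWeight n ≤ 1 :=
  pow_le_one₀ (by norm_num) (by norm_num)

theorem geomWeight_anti {m n : ℕ} (h : m ≤ n) : geomWeight n ≤ geomWeight m :=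
  pow_le_pow_of_le_one (by norm_num) (by norm_num) (by omega)

theorem sum_geomWeight_le (N : ℕ) : ∑ n ∈ Finset.range N, geomWeight n ≤ 1 := by
  have : ∀ N, ∑ n ∈ Finset.range N, geomWeight n = 1 - (1 / 2) ^ N := by
    intro N
    induction N with
    | zero => simp
    | succ N ih => rw [Finset.sum_range_succ, ih, geomWeight]; ring
  rw [this]
  have : (0 : ℝ) ≤ (1 / 2) ^ N := by positivity
  linarith

/-- The bound for the off-diagonal entries of an almost diagonal array. -/
noncomputable def almostDiagonalBound (a b c d : ℕ) : ℝ :=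
  geomWeight a * geomWeight b * geomWeight c * geomWeight d +
    (if b = d then geomWeight a * geomWeight c else 0) +
    (if a = c then geomWeight b * geomWeight d else 0)

/-- Rows take even positions and columns odd ones, so the two never coincide, and a ≤ b means 2a <
2b + 1. The largest of the four positions is either unique, making the entry small, or shared by
both columns (limit α) or by both rows (limit β). -/
theorem exists_almost_triangular {t : ℕ → ℕ → ℕ → ℕ → ℂ} {C : ℝ}
    (h1 : ∀ j k l, ∀ s : Finset ℕ, ∑ i ∈ s, ‖t i j k l‖ ^ 2 ≤ C)
    (h2 : ∀ i k l, ∀ s : Finset ℕ, ∑ j ∈ s, ‖t i j k l‖ ^ 2 ≤ C)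
    (h3 : ∀ i j l, ∀ s : Finset ℕ, ∑ k ∈ s, ‖t i j k l‖ ^ 2 ≤ C)
    (h4 : ∀ i j k, ∀ s : Finset ℕ, ∑ l ∈ s, ‖t i j k l‖ ^ 2 ≤ C)
    {η : ℝ} (hη : 0 < η) :
    ∃ (I J : ℕ → ℕ) (α β : ℂ), Function.Injective I ∧ Function.Injective J ∧ ∀ a b c d,
      ‖t (I a) (J b) (I c) (J d) - if a = c ∧ b = d then (if a ≤ b then α else β) else 0‖ ≤
        η * almostDiagonalBound a b c d := by
  -- The fourth power lets one weight at the largest position dominate the product of all four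
  -- weights; the factor 1/2 leaves room for the two errors in the paired cases.
  obtain ⟨p, α, β, hp, hoff, hA, hB⟩ := exists_almost_diagonal_seq h1 h2 h3 h4
    (ε := fun n => η / 2 * geomWeight n ^ 4) (fun n => by have := geomWeight_pos n; positivity)
  refine ⟨fun a => p (2 * a), fun b => p (2 * b + 1), α, β,
    fun a b h => by have := hp h; omega, fun a b h => by have := hp h; omega, fun a b c d => ?_⟩
  have wa := geomWeight_pos a
  have wb := geomWeight_pos b
  have wc := geomWeight_pos c
  have wd := geomWeight_pos d
  have hif1 : 0 ≤ if b = d then geomWeight a * geomWeight c else 0 := by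
    split_ifs <;> positivity
  have hif2 : 0 ≤ if a = c then geomWeight b * geomWeight d else 0 := by
    split_ifs <;> positivity
  have hunique : ∀ n, a ≤ n → b ≤ n → c ≤ n → d ≤ n →
      η / 2 * geomWeight n ^ 4 ≤ η * almostDiagonalBound a b c d := by
    intro n ha hb hc hd
    have hw : geomWeight n ^ 4 ≤ geomWeight a * geomWeight b * geomWeight c * geomWeight d := by
      have wn := geomWeight_pos n
      calc geomWeight n ^ 4 = geomWeight n * geomWeight n * geomWeight n * geomWeight n := by ring
        _ ≤ _ := by gcongr <;> exact geomWeight_anti (by assumption)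
    unfold almostDiagonalBound
    have : η / 2 * geomWeight n ^ 4 ≤ η * geomWeight n ^ 4 := by
      have := pow_pos (geomWeight_pos n) 4
      nlinarith
    refine this.trans (mul_le_mul_of_nonneg_left ?_ hη.le)
    linarith
  have hw4 : ∀ i j n m : ℕ, i ≤ n → j ≤ n → i ≤ m → j ≤ m →
      η / 2 * geomWeight n ^ 4 + η / 2 * geomWeight m ^ 4 ≤ η * (geomWeight i * geomWeight j) := by
    intro i j n m hi hj hi' hj'
    have key : ∀ n, i ≤ n → j ≤ n → geomWeight n ^ 4 ≤ geomWeight i * geomWeight j := by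
      intro n hi hj
      have wn := geomWeight_pos n
      have wi := geomWeight_pos i
      calc geomWeight n ^ 4 ≤ geomWeight n ^ 2 :=
            pow_le_pow_of_le_one wn.le (geomWeight_le_one n) (by norm_num)
        _ = geomWeight n * geomWeight n := by ring
        _ ≤ _ := by gcongr <;> exact geomWeight_anti (by assumption)
    have k1 := key n hi hj
    have k2 := key m hi' hj'
    nlinarith
  by_cases hbd : b = d ∧ a ≤ b ∧ c ≤ b
  · obtain ⟨rfl, hab, hcb⟩ := hbd
    have := hA (2 * b + 1) (2 * a) (by omega) (2 * c) (by omega)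
    have e : (if a = c ∧ b = b then (if a ≤ b then α else β) else 0) =
        if 2 * a = 2 * c then α else 0 := by
      simp [hab]
    rw [e]
    refine this.trans ((hw4 a c _ _ ?_ ?_ ?_ ?_).trans (mul_le_mul_of_nonneg_left ?_ hη.le))
    · omega
    · omega
    · omega
    · omega
    · unfold almostDiagonalBound
      rw [if_pos rfl]
      have : 0 < geomWeight a * geomWeight b * geomWeight c * geomWeight b := by positivity
      linarith
  by_cases hac : a = c ∧ b < a ∧ d < a
  · obtain ⟨rfl, hba, hda⟩ := hac
    have := hB (2 * a) (2 * b + 1) (by omega) (2 * d + 1) (by omega)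
    have e : (if a = a ∧ b = d then (if a ≤ b then α else β) else 0) =
        if 2 * b + 1 = 2 * d + 1 then β else 0 := by
      simp [hba.not_ge]
    rw [e]
    refine this.trans ((hw4 b d _ _ ?_ ?_ ?_ ?_).trans (mul_le_mul_of_nonneg_left ?_ hη.le))
    · omega
    · omega
    · omega
    · omega
    · unfold almostDiagonalBound
      rw [if_pos rfl]
      have : 0 < geomWeight a * geomWeight b * geomWeight a * geomWeight d := by positivity
      linarith
  rw [if_neg (by omega), sub_zero]
  -- The largest position is now unique: row a, column b, row c or column d.
  have hcases : (b < a ∧ c < a ∧ d < a) ∨ (a ≤ b ∧ c ≤ b ∧ d < b) ∨ (a < c ∧ b < c ∧ d < c) ∨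
      (a ≤ d ∧ b < d ∧ c ≤ d) := by omega
  rcases hcases with h | h | h | h
  · exact (hoff (2 * a) (2 * b + 1) (by omega) (2 * c) (by omega) (2 * d + 1) (by omega)).1.trans
      (hunique _ (by omega) (by omega) (by omega) (by omega))
  · exact (hoff (2 * b + 1) (2 * a) (by omega) (2 * c) (by omega) (2 * d + 1)
      (by omega)).2.1.trans (hunique _ (by omega) (by omega) (by omega) (by omega))
  · exact (hoff (2 * c) (2 * a) (by omega) (2 * b + 1) (by omega) (2 * d + 1)
      (by omega)).2.2.1.trans (hunique _ (by omega) (by omega) (by omega) (by omega))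
  · exact (hoff (2 * d + 1) (2 * a) (by omega) (2 * b + 1) (by omega) (2 * c)
      (by omega)).2.2.2.trans (hunique _ (by omega) (by omega) (by omega) (by omega))

/-! ### Haar-type matrices and unboundedness of triangular truncation -/

theorem sum_range_two_pow_succ {M : Type*} [AddCommMonoid M] (f : ℕ → M) (n : ℕ) :
    ∑ i ∈ Finset.range (2 ^ (n + 1)), f i =
      ∑ i ∈ Finset.range (2 ^ n), f i + ∑ i ∈ Finset.range (2 ^ n), f (2 ^ n + i) := by
  rw [show 2 ^ (n + 1) = 2 ^ n + 2 ^ n by ring, Finset.sum_range_add]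

/-- Matrices of order `2 ^ n` with operator norm at most `√n` whose upper triangular parts have
operator norm at least `n / 4`. -/
noncomputable def haarMatrix : ℕ → ℕ → ℕ → ℝ
  | 0, _, _ => 0
  | n + 1, i, j => (if i < 2 ^ n then 1 else -1) / 2 ^ (n + 1) +
      if (i < 2 ^ n ↔ j < 2 ^ n) then haarMatrix n (i % 2 ^ n) (j % 2 ^ n) else 0

section HaarMatrix

variable {n i j : ℕ}

theorem haarMatrix_succ_left_left (hi : i < 2 ^ n) (hj : j < 2 ^ n) :
    haarMatrix (n + 1) i j = 1 / 2 ^ (n + 1) + haarMatrix n i j := by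
  simp [haarMatrix, hi, hj, Nat.mod_eq_of_lt]

theorem haarMatrix_succ_left_right (hi : i < 2 ^ n) :
    haarMatrix (n + 1) i (2 ^ n + j) = 1 / 2 ^ (n + 1) := by
  simp [haarMatrix, hi]

theorem haarMatrix_succ_right_left (hj : j < 2 ^ n) :
    haarMatrix (n + 1) (2 ^ n + i) j = -1 / 2 ^ (n + 1) := by
  simp [haarMatrix, hj]

theorem haarMatrix_succ_right_right (hi : i < 2 ^ n) (hj : j < 2 ^ n) :
    haarMatrix (n + 1) (2 ^ n + i) (2 ^ n + j) = -1 / 2 ^ (n + 1) + haarMatrix n i j := by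
  simp [haarMatrix, Nat.mod_eq_of_lt hi, Nat.mod_eq_of_lt hj]

/-- The signs of the upper and lower halves cancel. This makes images orthogonal to constant
vectors, as the norm estimate requires. -/
theorem sum_haarMatrix_col (n : ℕ) {j : ℕ} (hj : j < 2 ^ n) :
    ∑ i ∈ Finset.range (2 ^ n), haarMatrix n i j = 0 := by
  induction n generalizing j with
  | zero => simp [haarMatrix]
  | succ n ih =>
    rw [sum_range_two_pow_succ]
    by_cases hjn : j < 2 ^ n
    · rw [Finset.sum_congr rfl fun i hi => haarMatrix_succ_left_left (Finset.mem_range.1 hi) hjn,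
        Finset.sum_congr rfl fun i _ => haarMatrix_succ_right_left hjn, Finset.sum_add_distrib,
        ih hjn]
      simp
      ring
    · obtain ⟨k, rfl⟩ := Nat.exists_eq_add_of_le (not_lt.1 hjn)
      have hk : k < 2 ^ n := by rw [pow_succ] at hj; omega
      rw [Finset.sum_congr rfl fun i hi => haarMatrix_succ_left_right (Finset.mem_range.1 hi),
        Finset.sum_congr rfl fun i hi => haarMatrix_succ_right_right (Finset.mem_range.1 hi) hk,
        Finset.sum_add_distrib, ih hk]
      simp
      ring

/-- The added constants cancel between the two diagonal blocks, the lower left block does not count,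
and the upper right block contributes 2 ^ n / 2. Hence S (n + 1) = 2 S n + 2 ^ n / 2. -/
theorem sum_haarMatrix_upper (n : ℕ) :
    ∑ i ∈ Finset.range (2 ^ n), ∑ j ∈ Finset.range (2 ^ n),
      (if i ≤ j then haarMatrix n i j else 0) = n * 2 ^ n / 4 := by
  induction n with
  | zero => simp [haarMatrix]
  | succ n ih =>
    rw [sum_range_two_pow_succ, ← Finset.sum_add_distrib]
    have key : ∀ i ∈ Finset.range (2 ^ n),
        (∑ j ∈ Finset.range (2 ^ (n + 1)), (if i ≤ j then haarMatrix (n + 1) i j else 0)) +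
        (∑ j ∈ Finset.range (2 ^ (n + 1)),
          (if 2 ^ n + i ≤ j then haarMatrix (n + 1) (2 ^ n + i) j else 0)) =
        2 * (∑ j ∈ Finset.range (2 ^ n), (if i ≤ j then haarMatrix n i j else 0)) + 1 / 2 := by
      intro i hi
      rw [Finset.mem_range] at hi
      rw [sum_range_two_pow_succ, sum_range_two_pow_succ]
      have e1 : ∀ j ∈ Finset.range (2 ^ n), (if i ≤ j then haarMatrix (n + 1) i j else 0) =
          (if i ≤ j then haarMatrix n i j else 0) + (if i ≤ j then 1 / 2 ^ (n + 1) else 0) := by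
        intro j hj
        rw [haarMatrix_succ_left_left hi (Finset.mem_range.1 hj)]
        split_ifs <;> ring
      have e2 : ∀ j ∈ Finset.range (2 ^ n),
          (if i ≤ 2 ^ n + j then haarMatrix (n + 1) i (2 ^ n + j) else 0) =
            1 / 2 ^ (n + 1) := by
        intro j hj
        rw [haarMatrix_succ_left_right hi, if_pos (by omega)]
      have e3 : ∀ j ∈ Finset.range (2 ^ n),
          (if 2 ^ n + i ≤ j then haarMatrix (n + 1) (2 ^ n + i) j else 0) = 0 := by
        intro j hj
        rw [Finset.mem_range] at hj
        rw [if_neg (by omega)]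
      have e4 : ∀ j ∈ Finset.range (2 ^ n),
          (if 2 ^ n + i ≤ 2 ^ n + j then haarMatrix (n + 1) (2 ^ n + i) (2 ^ n + j) else 0) =
          (if i ≤ j then haarMatrix n i j else 0) - (if i ≤ j then 1 / 2 ^ (n + 1) else 0) := by
        intro j hj
        rw [haarMatrix_succ_right_right hi (Finset.mem_range.1 hj)]
        simp only [Nat.add_le_add_iff_left]
        split_ifs <;> ring
      rw [Finset.sum_congr rfl e1, Finset.sum_congr rfl e2, Finset.sum_congr rfl e3,
        Finset.sum_congr rfl e4, Finset.sum_add_distrib, Finset.sum_sub_distrib]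
      have : ∑ j ∈ Finset.range (2 ^ n), (1 : ℝ) / 2 ^ (n + 1) = 1 / 2 := by
        rw [Finset.sum_const, Finset.card_range, nsmul_eq_mul, pow_succ]
        push_cast
        field_simp
      rw [this]
      simp
      ring
    rw [Finset.sum_congr rfl key, Finset.sum_add_distrib, ← Finset.mul_sum, ih]
    simp
    ring

/-- The new rank-one part contributes s on the upper half and -s on the lower half, with s the mean
of u. Zero column sums make this orthogonal to the block diagonal part, so squared norms add, and
Cauchy–Schwarz bounds the new term by the squared norm of u: the constant grows by one. -/
theorem sum_haarMatrix_mul_norm_sq_le (n : ℕ) (u : ℕ → ℂ) :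
    ∑ i ∈ Finset.range (2 ^ n), ‖∑ j ∈ Finset.range (2 ^ n), (haarMatrix n i j : ℂ) * u j‖ ^ 2 ≤
      n * ∑ j ∈ Finset.range (2 ^ n), ‖u j‖ ^ 2 := by
  induction n generalizing u with
  | zero => simp [haarMatrix]
  | succ n ih =>
    set y : ℕ → ℂ := fun i => ∑ j ∈ Finset.range (2 ^ n), (haarMatrix n i j : ℂ) * u j with hy
    set z : ℕ → ℂ := fun i => ∑ j ∈ Finset.range (2 ^ n), (haarMatrix n i j : ℂ) * u (2 ^ n + j)
      with hz
    set s : ℂ := (∑ j ∈ Finset.range (2 ^ (n + 1)), u j) / 2 ^ (n + 1) with hs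
    have hzero : ∀ w : ℕ → ℂ, ∑ i ∈ Finset.range (2 ^ n),
        ∑ j ∈ Finset.range (2 ^ n), (haarMatrix n i j : ℂ) * w j = 0 := by
      intro w
      rw [Finset.sum_comm]
      refine Finset.sum_eq_zero fun j hj => ?_
      rw [← Finset.sum_mul, ← Complex.ofReal_sum, sum_haarMatrix_col n (Finset.mem_range.1 hj)]
      simp
    have hs' : s = ∑ j ∈ Finset.range (2 ^ n), 1 / 2 ^ (n + 1) * u j +
        ∑ j ∈ Finset.range (2 ^ n), 1 / 2 ^ (n + 1) * u (2 ^ n + j) := by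
      rw [hs, sum_range_two_pow_succ, ← Finset.mul_sum, ← Finset.mul_sum]
      ring
    have e1 : ∀ i ∈ Finset.range (2 ^ n),
        ‖∑ j ∈ Finset.range (2 ^ (n + 1)), (haarMatrix (n + 1) i j : ℂ) * u j‖ ^ 2 =
          ‖y i + s‖ ^ 2 := by
      intro i hi
      rw [Finset.mem_range] at hi
      have c1 : ∀ j ∈ Finset.range (2 ^ n), (haarMatrix (n + 1) i j : ℂ) * u j =
          haarMatrix n i j * u j + 1 / 2 ^ (n + 1) * u j := by
        intro j hj
        rw [haarMatrix_succ_left_left hi (Finset.mem_range.1 hj)]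
        push_cast
        ring
      have c2 : ∀ j ∈ Finset.range (2 ^ n), (haarMatrix (n + 1) i (2 ^ n + j) : ℂ) *
          u (2 ^ n + j) = 1 / 2 ^ (n + 1) * u (2 ^ n + j) := by
        intro j hj
        rw [haarMatrix_succ_left_right hi]
        push_cast
        ring
      rw [sum_range_two_pow_succ, Finset.sum_congr rfl c1, Finset.sum_congr rfl c2,
        Finset.sum_add_distrib, add_assoc, ← hs']
    have e2 : ∀ i ∈ Finset.range (2 ^ n),
        ‖∑ j ∈ Finset.range (2 ^ (n + 1)), (haarMatrix (n + 1) (2 ^ n + i) j : ℂ) * u j‖ ^ 2 =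
          ‖z i + -s‖ ^ 2 := by
      intro i hi
      rw [Finset.mem_range] at hi
      have c1 : ∀ j ∈ Finset.range (2 ^ n), (haarMatrix (n + 1) (2 ^ n + i) j : ℂ) * u j =
          -(1 / 2 ^ (n + 1) * u j) := by
        intro j hj
        rw [haarMatrix_succ_right_left (Finset.mem_range.1 hj)]
        push_cast
        ring
      have c2 : ∀ j ∈ Finset.range (2 ^ n), (haarMatrix (n + 1) (2 ^ n + i) (2 ^ n + j) : ℂ) *
          u (2 ^ n + j) = haarMatrix n i j * u (2 ^ n + j) - 1 / 2 ^ (n + 1) * u (2 ^ n + j) := by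
        intro j hj
        rw [haarMatrix_succ_right_right hi (Finset.mem_range.1 hj)]
        push_cast
        ring
      rw [sum_range_two_pow_succ, Finset.sum_congr rfl c1, Finset.sum_congr rfl c2,
        Finset.sum_sub_distrib, Finset.sum_neg_distrib, hs']
      congr 2
      simp only [hz]
      abel
    have hadd : ∀ (y : ℕ → ℂ) (s : ℂ), ∑ i ∈ Finset.range (2 ^ n), y i = 0 →
        ∑ i ∈ Finset.range (2 ^ n), ‖y i + s‖ ^ 2 =
          ∑ i ∈ Finset.range (2 ^ n), ‖y i‖ ^ 2 + 2 ^ n * ‖s‖ ^ 2 := by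
      intro y s h0
      have : ∀ i, ‖y i + s‖ ^ 2 = ‖y i‖ ^ 2 + 2 * (inner ℝ (y i) s) + ‖s‖ ^ 2 := fun i =>
        norm_add_sq_real _ _
      simp only [this, Finset.sum_add_distrib, ← Finset.mul_sum, ← sum_inner, h0]
      simp
    have hcs : 2 ^ (n + 1) * ‖s‖ ^ 2 ≤ ∑ j ∈ Finset.range (2 ^ (n + 1)), ‖u j‖ ^ 2 := by
      have h1 : ‖∑ j ∈ Finset.range (2 ^ (n + 1)), u j‖ ^ 2 ≤
          2 ^ (n + 1) * ∑ j ∈ Finset.range (2 ^ (n + 1)), ‖u j‖ ^ 2 := by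
        have h2 := sq_sum_le_card_mul_sum_sq (s := Finset.range (2 ^ (n + 1)))
          (f := fun j => ‖u j‖)
        have h3 := norm_sum_le (Finset.range (2 ^ (n + 1))) u
        simp only [Finset.card_range, Nat.cast_pow, Nat.cast_ofNat] at h2
        exact (pow_le_pow_left₀ (norm_nonneg _) h3 2).trans h2
      rw [hs, norm_div, div_pow]
      have hp : (0 : ℝ) < 2 ^ (n + 1) := by positivity
      have : ‖(2 : ℂ) ^ (n + 1)‖ = 2 ^ (n + 1) := by simp
      rw [this, ← mul_div_assoc, div_le_iff₀ (by positivity)]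
      nlinarith
    rw [sum_range_two_pow_succ, Finset.sum_congr rfl e1, Finset.sum_congr rfl e2, hadd y s (hzero _), hadd z (-s) (hzero _),
      norm_neg]
    have i1 := ih u
    have i2 := ih fun j => u (2 ^ n + j)
    have hsplit := sum_range_two_pow_succ (fun j => ‖u j‖ ^ 2) n
    have : (2 : ℝ) ^ (n + 1) = 2 ^ n + 2 ^ n := by ring
    rw [this] at hcs
    push_cast
    simp only [hy, hz]
    nlinarith

end HaarMatrix

/-- All entries together sum to zero, so only the jump α - β survives, multiplied by n 2 ^ n / 4.
This outgrows √n 2 ^ n unless α = β. -/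
theorem eq_of_triangular_multiplier_bound {α β : ℂ} {C : ℝ}
    (h : ∀ n : ℕ, ‖∑ a ∈ Finset.range (2 ^ n), ∑ b ∈ Finset.range (2 ^ n),
      (if a ≤ b then α else β) * (haarMatrix n a b : ℂ)‖ ≤ C * √n * 2 ^ n) : α = β := by
  have hsum : ∀ n : ℕ, ∑ a ∈ Finset.range (2 ^ n), ∑ b ∈ Finset.range (2 ^ n),
      (if a ≤ b then α else β) * (haarMatrix n a b : ℂ) = (α - β) * (n * 2 ^ n / 4) := by
    intro n
    have e : ∀ a b, (if a ≤ b then α else β) * (haarMatrix n a b : ℂ) =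
        (α - β) * ((if a ≤ b then haarMatrix n a b else 0 : ℝ) : ℂ) +
          β * (haarMatrix n a b : ℂ) := by
      intro a b
      split_ifs <;> push_cast <;> ring
    simp only [e, Finset.sum_add_distrib, ← Finset.mul_sum]
    have h0 : ∑ a ∈ Finset.range (2 ^ n), ∑ b ∈ Finset.range (2 ^ n),
        (haarMatrix n a b : ℂ) = 0 := by
      rw [Finset.sum_comm]
      refine Finset.sum_eq_zero fun j hj => ?_
      rw [← Complex.ofReal_sum, sum_haarMatrix_col n (Finset.mem_range.1 hj), Complex.ofReal_zero]
    rw [h0, mul_zero, add_zero]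
    congr 1
    have := congrArg (fun r : ℝ => (r : ℂ)) (sum_haarMatrix_upper n)
    push_cast at this ⊢
    exact this
  have hb : ∀ n : ℕ, ‖α - β‖ * √n ≤ 4 * C := by
    intro n
    have := h n
    rw [hsum] at this
    have e : ‖(α - β) * ((n : ℂ) * 2 ^ n / 4)‖ = ‖α - β‖ * (n * 2 ^ n / 4) := by simp
    rw [e] at this
    have hn : (n : ℝ) = √n * √n := (Real.mul_self_sqrt (Nat.cast_nonneg n)).symm
    have hp : (0 : ℝ) < 2 ^ n := by positivity
    rcases Nat.eq_zero_or_pos n with rfl | hpos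
    -- For n = 0 the claim is C ≥ 0, which is read off from the hypothesis at n = 1.
    · have h1 := h 1
      have : 0 ≤ C * √(1 : ℕ) * 2 ^ 1 := (norm_nonneg _).trans h1
      simp at this ⊢
      linarith
    · have hs : 0 < √(n : ℝ) := Real.sqrt_pos.2 (by exact_mod_cast hpos)
      rw [hn] at this
      have h2 : (‖α - β‖ * √n) * (√n * 2 ^ n) ≤ (4 * C) * (√n * 2 ^ n) := by
        rw [← hn] at this
        have : ‖α - β‖ * (√n * √n * 2 ^ n / 4) ≤ C * √n * 2 ^ n := by rwa [← hn]
        nlinarith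
      exact le_of_mul_le_mul_right h2 (by positivity)
  by_contra hne
  have hpos : 0 < ‖α - β‖ := norm_pos_iff.2 (sub_ne_zero.2 hne)
  have ht : Tendsto (fun n : ℕ => ‖α - β‖ * √(n : ℝ)) atTop atTop :=
    (Real.tendsto_sqrt_atTop.comp tendsto_natCast_atTop_atTop).const_mul_atTop hpos
  obtain ⟨n, hn⟩ := (ht.eventually_gt_atTop (4 * C)).exists
  exact absurd (hb n) (not_le.2 hn)

/-! ### Summing the off-diagonal errors -/

theorem sum_mul_norm_le_of_sq_le {s : Finset ℕ} {f g : ℕ → ℂ} {A B : ℝ} (hA : 0 ≤ A) (hB : 0 ≤ B)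
    (hf : ∑ i ∈ s, ‖f i‖ ^ 2 ≤ A ^ 2) (hg : ∑ i ∈ s, ‖g i‖ ^ 2 ≤ B ^ 2) :
    ∑ i ∈ s, ‖f i‖ * ‖g i‖ ≤ A * B := by
  have h := Finset.sum_mul_sq_le_sq_mul_sq s (fun i => ‖f i‖) fun i => ‖g i‖
  have h2 : (∑ i ∈ s, ‖f i‖ ^ 2) * ∑ i ∈ s, ‖g i‖ ^ 2 ≤ A ^ 2 * B ^ 2 :=
    mul_le_mul hf hg (Finset.sum_nonneg fun _ _ => by positivity) (by positivity)
  exact abs_le_of_sq_le_sq' (by rw [mul_pow]; exact h.trans h2) (by positivity) |>.2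

theorem norm_le_of_sum_sq_le {s : Finset ℕ} {f : ℕ → ℂ} {A : ℝ} (hA : 0 ≤ A)
    (hf : ∑ i ∈ s, ‖f i‖ ^ 2 ≤ A ^ 2) {i : ℕ} (hi : i ∈ s) : ‖f i‖ ≤ A := by
  have h1 := Finset.single_le_sum (f := fun i => ‖f i‖ ^ 2) (fun _ _ => by positivity) hi
  exact abs_le_of_sq_le_sq' (h1.trans hf) hA |>.2

/-- Each of the three summands of `almostDiagonalBound` costs at most M U V. In the first, all
entries are bounded and the weights sum; in the other two, Cauchy–Schwarz handles the repeated index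
(a row of x against u, a column against v) and the weights sum the remaining two. -/
theorem norm_sum_almostDiagonal_le {e : ℕ → ℕ → ℕ → ℕ → ℂ} {η : ℝ}
    (he : ∀ a b c d, ‖e a b c d‖ ≤ η * almostDiagonalBound a b c d) (hη : 0 ≤ η)
    {N : ℕ} {x : ℕ → ℕ → ℂ} {u v : ℕ → ℂ} {M U V : ℝ} (hM : 0 ≤ M) (hU : 0 ≤ U) (hV : 0 ≤ V)
    (hrow : ∀ a, ∑ b ∈ Finset.range N, ‖x a b‖ ^ 2 ≤ M ^ 2)
    (hcol : ∀ b, ∑ a ∈ Finset.range N, ‖x a b‖ ^ 2 ≤ M ^ 2)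
    (hu : ∑ d ∈ Finset.range N, ‖u d‖ ^ 2 ≤ U ^ 2) (hv : ∑ c ∈ Finset.range N, ‖v c‖ ^ 2 ≤ V ^ 2) :
    ‖∑ a ∈ Finset.range N, ∑ b ∈ Finset.range N, ∑ c ∈ Finset.range N, ∑ d ∈ Finset.range N,
      e a b c d * x a b * u d * v c‖ ≤ 3 * η * (M * U * V) := by
  have w0 := fun n => (geomWeight_pos n).le
  have hMUV : 0 ≤ M * U * V := by positivity
  have hw1 := sum_geomWeight_le N
  have hw0 : 0 ≤ ∑ n ∈ Finset.range N, geomWeight n := Finset.sum_nonneg fun n _ => w0 n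
  have hw2 : ∀ K : ℝ, 0 ≤ K → ∑ a ∈ Finset.range N, ∑ c ∈ Finset.range N,
      geomWeight a * geomWeight c * K ≤ K := by
    intro K hK
    simp only [← Finset.sum_mul, ← Finset.mul_sum]
    have : (∑ n ∈ Finset.range N, geomWeight n) * (∑ n ∈ Finset.range N, geomWeight n) ≤ 1 :=
      mul_le_one₀ hw1 hw0 hw1
    nlinarith
  have hx : ∀ a, ∀ b ∈ Finset.range N, ‖x a b‖ ≤ M := fun a b hb =>
    norm_le_of_sum_sq_le hM (hrow a) hb
  have hu' : ∀ d ∈ Finset.range N, ‖u d‖ ≤ U := fun d hd => norm_le_of_sum_sq_le hU hu hd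
  have hv' : ∀ c ∈ Finset.range N, ‖v c‖ ≤ V := fun c hc => norm_le_of_sum_sq_le hV hv hc
  have s1 : ∑ a ∈ Finset.range N, ∑ b ∈ Finset.range N, ∑ c ∈ Finset.range N,
      ∑ d ∈ Finset.range N, (geomWeight a * geomWeight b * geomWeight c * geomWeight d) *
        (‖x a b‖ * ‖u d‖ * ‖v c‖) ≤ M * U * V := by
    calc _ ≤ ∑ a ∈ Finset.range N, ∑ b ∈ Finset.range N, geomWeight a * geomWeight b *
          ∑ c ∈ Finset.range N, ∑ d ∈ Finset.range N,
          (geomWeight c * geomWeight d) * (M * U * V) := by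
          simp only [Finset.mul_sum]
          refine Finset.sum_le_sum fun a _ => Finset.sum_le_sum fun b hb =>
            Finset.sum_le_sum fun c hc => Finset.sum_le_sum fun d hd => ?_
          have := hx a b hb
          have := hu' d hd
          have := hv' c hc
          calc _ ≤ (geomWeight a * geomWeight b * geomWeight c * geomWeight d) * (M * U * V) := by
                refine mul_le_mul_of_nonneg_left (by gcongr) ?_
                have := w0 a; have := w0 b; have := w0 c; have := w0 d
                positivity
            _ = _ := by ring
      _ ≤ ∑ a ∈ Finset.range N, ∑ b ∈ Finset.range N, geomWeight a * geomWeight b *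
          (M * U * V) := by
          refine Finset.sum_le_sum fun a _ => Finset.sum_le_sum fun b _ => ?_
          exact mul_le_mul_of_nonneg_left (hw2 _ hMUV) (mul_nonneg (w0 a) (w0 b))
      _ ≤ _ := hw2 _ hMUV
  have s2 : ∑ a ∈ Finset.range N, ∑ b ∈ Finset.range N, ∑ c ∈ Finset.range N,
      ∑ d ∈ Finset.range N, (if b = d then geomWeight a * geomWeight c else 0) *
        (‖x a b‖ * ‖u d‖ * ‖v c‖) ≤ M * U * V := by
    calc _ = ∑ a ∈ Finset.range N, ∑ c ∈ Finset.range N, geomWeight a * geomWeight c *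
          ((∑ b ∈ Finset.range N, ‖x a b‖ * ‖u b‖) * ‖v c‖) := by
          refine Finset.sum_congr rfl fun a _ => ?_
          rw [Finset.sum_comm]
          refine Finset.sum_congr rfl fun c _ => ?_
          rw [Finset.sum_mul, Finset.mul_sum]
          refine Finset.sum_congr rfl fun b hb => ?_
          simp only [ite_mul, zero_mul, Finset.sum_ite_eq, if_pos hb]
      _ ≤ ∑ a ∈ Finset.range N, ∑ c ∈ Finset.range N, geomWeight a * geomWeight c *
          (M * U * V) := by
          refine Finset.sum_le_sum fun a _ => Finset.sum_le_sum fun c hc => ?_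
          refine mul_le_mul_of_nonneg_left ?_ (mul_nonneg (w0 a) (w0 c))
          exact mul_le_mul (sum_mul_norm_le_of_sq_le hM hU (hrow a) hu) (hv' c hc)
            (norm_nonneg _) (by positivity)
      _ ≤ _ := hw2 _ hMUV
  have s3 : ∑ a ∈ Finset.range N, ∑ b ∈ Finset.range N, ∑ c ∈ Finset.range N,
      ∑ d ∈ Finset.range N, (if a = c then geomWeight b * geomWeight d else 0) *
        (‖x a b‖ * ‖u d‖ * ‖v c‖) ≤ M * U * V := by
    calc _ = ∑ b ∈ Finset.range N, ∑ d ∈ Finset.range N, geomWeight b * geomWeight d *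
          ((∑ a ∈ Finset.range N, ‖x a b‖ * ‖v a‖) * ‖u d‖) := by
          rw [Finset.sum_comm]
          refine Finset.sum_congr rfl fun b _ => ?_
          have : ∀ a ∈ Finset.range N, ∑ c ∈ Finset.range N, ∑ d ∈ Finset.range N,
              (if a = c then geomWeight b * geomWeight d else 0) * (‖x a b‖ * ‖u d‖ * ‖v c‖) =
              ∑ d ∈ Finset.range N, geomWeight b * geomWeight d *
                ((‖x a b‖ * ‖v a‖) * ‖u d‖) := by
            intro a ha
            rw [Finset.sum_comm]
            refine Finset.sum_congr rfl fun d _ => ?_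
            simp only [ite_mul, zero_mul, Finset.sum_ite_eq, if_pos ha]
            ring
          rw [Finset.sum_congr rfl this, Finset.sum_comm]
          refine Finset.sum_congr rfl fun d _ => ?_
          rw [Finset.sum_mul, Finset.mul_sum]
      _ ≤ ∑ b ∈ Finset.range N, ∑ d ∈ Finset.range N, geomWeight b * geomWeight d *
          (M * U * V) := by
          refine Finset.sum_le_sum fun b _ => Finset.sum_le_sum fun d hd => ?_
          refine mul_le_mul_of_nonneg_left ?_ (mul_nonneg (w0 b) (w0 d))
          calc _ ≤ M * V * U := mul_le_mul (sum_mul_norm_le_of_sq_le hM hV (hcol b) hv) (hu' d hd)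
                (norm_nonneg _) (by positivity)
            _ = _ := by ring
      _ ≤ _ := hw2 _ hMUV
  calc _ ≤ ∑ a ∈ Finset.range N, ∑ b ∈ Finset.range N, ∑ c ∈ Finset.range N,
      ∑ d ∈ Finset.range N, η * almostDiagonalBound a b c d * (‖x a b‖ * ‖u d‖ * ‖v c‖) := by
        refine (norm_sum_le _ _).trans (Finset.sum_le_sum fun a _ => ?_)
        refine (norm_sum_le _ _).trans (Finset.sum_le_sum fun b _ => ?_)
        refine (norm_sum_le _ _).trans (Finset.sum_le_sum fun c _ => ?_)
        refine (norm_sum_le _ _).trans (Finset.sum_le_sum fun d _ => ?_)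
        rw [norm_mul, norm_mul, norm_mul, mul_assoc, mul_assoc, ← mul_assoc (‖x a b‖)]
        exact mul_le_mul_of_nonneg_right (he a b c d) (by positivity)
    _ ≤ η * (M * U * V + M * U * V + M * U * V) := by
        have h := add_le_add (add_le_add s1 s2) s3
        simp only [← Finset.sum_add_distrib] at h
        refine le_trans (le_of_eq ?_) (mul_le_mul_of_nonneg_left h hη)
        simp only [Finset.mul_sum, almostDiagonalBound]
        refine Finset.sum_congr rfl fun a _ => Finset.sum_congr rfl fun b _ =>
          Finset.sum_congr rfl fun c _ => Finset.sum_congr rfl fun d _ => ?_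
        ring
    _ = _ := by ring

/-! ### Orthonormal systems and ℓ² duality -/

/-- Distinct orthonormal vectors are at distance √2, so the balls of radius 1/2 around them are
disjoint. -/
theorem Orthonormal.countable_of_separableSpace {ι H : Type*} [NormedAddCommGroup H]
    [InnerProductSpace ℂ H] [TopologicalSpace.SeparableSpace H] {v : ι → H}
    (hv : Orthonormal ℂ v) : Countable ι := by
  have hd : ∀ i j, i ≠ j → 1 ≤ dist (v i) (v j) := by
    intro i j hij
    have h := norm_sub_sq (𝕜 := ℂ) (v i) (v j)
    rw [hv.1 i, hv.1 j, hv.2 hij] at h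
    rw [dist_eq_norm]
    have h2 : ‖v i - v j‖ ^ 2 = 2 := by rw [h]; simp; norm_num
    nlinarith [norm_nonneg (v i - v j)]
  refine Set.countable_univ_iff.1 (Set.PairwiseDisjoint.countable_of_isOpen
    (s := fun i => Metric.ball (v i) (1 / 2)) ?_ (fun _ _ => Metric.isOpen_ball)
    fun i _ => ⟨v i, Metric.mem_ball_self (by norm_num)⟩)
  intro i _ j _ hij
  refine Metric.ball_disjoint_ball ?_
  norm_num
  exact hd i j hij

theorem exists_hilbertBasis_nat (H : Type*) [NormedAddCommGroup H] [InnerProductSpace ℂ H]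
    [CompleteSpace H] [TopologicalSpace.SeparableSpace H] (hH : ¬ FiniteDimensional ℂ H) :
    Nonempty (HilbertBasis ℕ ℂ H) := by
  obtain ⟨w, b, hb⟩ := exists_hilbertBasis ℂ H
  have hc : Countable w := b.orthonormal.countable_of_separableSpace
  have hi : Infinite w := by
    by_contra hfin
    rw [not_infinite_iff_finite] at hfin
    have := Fintype.ofFinite w
    exact hH b.toOrthonormalBasis.toBasis.finiteDimensional_of_finite
  obtain ⟨f⟩ := nonempty_equiv_of_countable (α := ℕ) (β := w)
  refine ⟨HilbertBasis.mk (v := fun n => b (f n)) (b.orthonormal.comp f f.injective) ?_⟩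
  have : Set.range (fun n => b (f n)) = Set.range b := f.surjective.range_comp b
  rw [this, b.dense_span]

section Orthonormal

variable {ι H : Type*} [NormedAddCommGroup H] [InnerProductSpace ℂ H] {v : ι → H}

theorem Orthonormal.norm_sum_smul_sq (hv : Orthonormal ℂ v) (s : Finset ι) (a : ι → ℂ) :
    ‖∑ i ∈ s, a i • v i‖ ^ 2 = ∑ i ∈ s, ‖a i‖ ^ 2 := by
  simpa using hv.orthogonalFamily.norm_sum a s

end Orthonormal

/-- Self-duality of ℓ²: test with a the conjugate of c and cancel one factor. -/
theorem sum_norm_sq_le_of_forall_norm_sum_le {ι : Type*} {s : Finset ι} {c : ι → ℂ} {C : ℝ}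
    (hC : 0 ≤ C) (h : ∀ a : ι → ℂ, ‖∑ i ∈ s, a i * c i‖ ^ 2 ≤ C * ∑ i ∈ s, ‖a i‖ ^ 2) :
    ∑ i ∈ s, ‖c i‖ ^ 2 ≤ C := by
  have h1 := h fun i => (starRingEnd ℂ) (c i)
  simp only [RCLike.conj_mul, RCLike.norm_conj] at h1
  have h2 : ‖∑ i ∈ s, ((‖c i‖ : ℂ)) ^ 2‖ = ∑ i ∈ s, ‖c i‖ ^ 2 := by
    have : ∑ i ∈ s, ((‖c i‖ : ℂ)) ^ 2 = ((∑ i ∈ s, ‖c i‖ ^ 2 : ℝ) : ℂ) := by push_cast; rfl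
    rw [this, Complex.norm_real, Real.norm_of_nonneg (Finset.sum_nonneg fun _ _ => by positivity)]
  have h3 : (∑ i ∈ s, ‖c i‖ ^ 2) ^ 2 ≤ C * ∑ i ∈ s, ‖c i‖ ^ 2 := by
    rw [← h2]; simpa [h2] using h1
  rcases (Finset.sum_nonneg (s := s) (f := fun i => ‖c i‖ ^ 2)
    fun _ _ => by positivity).eq_or_lt with h0 | h0
  · rwa [← h0]
  · rw [pow_two] at h3
    exact le_of_mul_le_mul_right h3 h0

/-! ### Rank-one operators and two-sided multiplication -/

namespace CompactOperators

variable {H : Type*} [NormedAddCommGroup H] [InnerProductSpace ℂ H]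

/-- The operator `z ↦ ⟪y, z⟫ x` as a compact operator. -/
noncomputable def ofRankOne (x y : H) : CompactOperators H :=
  ⟨rankOne ℂ x y, by
    have h : IsCompactOperator (innerSL ℂ y : H →L[ℂ] ℂ) :=
      isCompactOperator_of_locallyCompactSpace_dom _
    exact h.clm_comp (ContinuousLinearMap.toSpanSingleton ℂ x)⟩

@[simp] theorem coe_ofRankOne (x y : H) : (ofRankOne x y : H →L[ℂ] H) = rankOne ℂ x y := rfl

theorem norm_ofRankOne (x y : H) : ‖ofRankOne x y‖ = ‖x‖ * ‖y‖ :=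
  norm_rankOne x y

theorem ofRankOne_sum_smul_left {ι : Type*} (s : Finset ι) (a : ι → ℂ) (v : ι → H) (y : H) :
    ofRankOne (∑ i ∈ s, a i • v i) y = ∑ i ∈ s, a i • ofRankOne (v i) y := by
  apply Subtype.ext
  simp

theorem ofRankOne_sum_smul_right {ι : Type*} (s : Finset ι) (a : ι → ℂ) (v : ι → H) (x : H) :
    ofRankOne x (∑ i ∈ s, (starRingEnd ℂ) (a i) • v i) = ∑ i ∈ s, a i • ofRankOne x (v i) := by
  apply Subtype.ext
  simp

/-- The map `x ↦ A x B` on compact operators. -/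
noncomputable def sandwich (A B : H →L[ℂ] H) : CompactOperators H →L[ℂ] CompactOperators H :=
  LinearMap.mkContinuous
    { toFun := fun x => ⟨A ∘L (x : H →L[ℂ] H) ∘L B,
        (IsCompactOperator.comp_clm (x.2 : IsCompactOperator (x : H →L[ℂ] H)) B).clm_comp A⟩
      map_add' := fun x y => by apply Subtype.ext; ext; simp
      map_smul' := fun c x => by apply Subtype.ext; ext; simp }
    (‖A‖ * ‖B‖) fun x => by
      calc ‖A ∘L (x : H →L[ℂ] H) ∘L B‖ ≤ ‖A‖ * (‖(x : H →L[ℂ] H)‖ * ‖B‖) :=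
            (ContinuousLinearMap.opNorm_comp_le _ _).trans
              (mul_le_mul_of_nonneg_left (ContinuousLinearMap.opNorm_comp_le _ _) (norm_nonneg _))
        _ = ‖A‖ * ‖B‖ * ‖x‖ := by rw [mul_comm ‖(x : H →L[ℂ] H)‖, mul_assoc]; rfl

@[simp] theorem coe_sandwich (A B : H →L[ℂ] H) (x : CompactOperators H) :
    (sandwich A B x : H →L[ℂ] H) = A ∘L (x : H →L[ℂ] H) ∘L B := rfl

theorem norm_sandwich_le (A B : H →L[ℂ] H) : ‖sandwich A B‖ ≤ ‖A‖ * ‖B‖ :=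
  LinearMap.mkContinuous_norm_le _ (by positivity) _

/-- Bounded operators tending to zero pointwise tend to zero in norm after composition with a
compact operator. -/
theorem tendsto_comp_zero {A : ℕ → H →L[ℂ] H} {C : ℝ} (hC : ∀ n, ‖A n‖ ≤ C) {l : Filter ℕ}
    (hA : ∀ h, Tendsto (fun n => A n h) l (𝓝 0)) (x : CompactOperators H) :
    Tendsto (fun n => A n ∘L (x : H →L[ℂ] H)) l (𝓝 0) := by
  have hC0 : 0 ≤ C := (norm_nonneg _).trans (hC 0)
  have hcomp : IsCompact (closure ((x : H →L[ℂ] H) '' Metric.closedBall 0 1)) :=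
    IsCompactOperator.isCompact_closure_image_closedBall (f := ((x : H →L[ℂ] H) : H →ₗ[ℂ] H)) x.2 1
  rw [Metric.tendsto_nhds]
  intro ε hε
  -- A finite net of the image of the unit ball makes pointwise convergence uniform; C + 1 keeps the
  -- radius meaningful when C = 0.
  obtain ⟨t, ht, hcov⟩ := Metric.totallyBounded_iff.1 hcomp.totallyBounded (ε / (2 * (C + 1)))
    (by positivity)
  have hev : ∀ᶠ n in l, ∀ y ∈ t, ‖A n y‖ ≤ ε / 4 := by
    rw [ht.eventually_all]
    intro y _
    exact (hA y).norm.eventually_le_const (by simpa using by positivity)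
  filter_upwards [hev] with n hn
  rw [dist_zero_right]
  have key : ‖A n ∘L (x : H →L[ℂ] H)‖ ≤ 3 / 4 * ε := by
    refine ContinuousLinearMap.opNorm_le_of_unit_norm (by positivity) fun h hh => ?_
    have hmem : (x : H →L[ℂ] H) h ∈ closure ((x : H →L[ℂ] H) '' Metric.closedBall 0 1) :=
      subset_closure ⟨h, by simp [hh], rfl⟩
    obtain ⟨y, hy, hxy⟩ := Set.mem_iUnion₂.1 (hcov hmem)
    rw [Metric.mem_ball, dist_eq_norm] at hxy
    calc ‖A n ((x : H →L[ℂ] H) h)‖ = ‖A n ((x : H →L[ℂ] H) h - y) + A n y‖ := by simp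
      _ ≤ C * (ε / (2 * (C + 1))) + ε / 4 := by
          refine (norm_add_le _ _).trans (add_le_add ?_ (hn y hy))
          exact ((A n).le_opNorm _).trans (mul_le_mul (hC n) hxy.le (norm_nonneg _) hC0)
      _ ≤ ε / 2 + ε / 4 := by
          gcongr
          rw [mul_div_assoc', div_le_div_iff₀ (by positivity) (by positivity)]
          nlinarith
      _ = 3 / 4 * ε := by ring
  linarith

end CompactOperators

/-! ### Approximation by finite sections -/

namespace HilbertBasis

variable {H : Type*} [NormedAddCommGroup H] [InnerProductSpace ℂ H] (e : HilbertBasis ℕ ℂ H)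

/-- The orthogonal projection onto the span of the first `N` basis vectors. -/
noncomputable def partialProj (N : ℕ) : H →L[ℂ] H :=
  ∑ a ∈ Finset.range N, rankOne ℂ (e a) (e a)

theorem partialProj_apply (N : ℕ) (h : H) :
    e.partialProj N h = ∑ a ∈ Finset.range N, inner ℂ (e a) h • e a := by
  simp [partialProj]

theorem norm_partialProj_apply_le (N : ℕ) (h : H) : ‖e.partialProj N h‖ ≤ ‖h‖ := by
  have h1 : ‖e.partialProj N h‖ ^ 2 ≤ ‖h‖ ^ 2 := by
    rw [partialProj_apply, e.orthonormal.norm_sum_smul_sq]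
    exact e.orthonormal.sum_inner_products_le h
  exact abs_le_of_sq_le_sq' h1 (norm_nonneg _) |>.2

theorem norm_partialProj_le (N : ℕ) : ‖e.partialProj N‖ ≤ 1 :=
  ContinuousLinearMap.opNorm_le_bound _ zero_le_one fun h => by
    simpa using e.norm_partialProj_apply_le N h

theorem tendsto_partialProj_apply (h : H) :
    Tendsto (fun N => e.partialProj N h) atTop (𝓝 h) := by
  simp only [partialProj_apply]
  simpa [e.repr_apply_apply] using (e.hasSum_repr h).tendsto_sum_nat

theorem norm_one_sub_partialProj_le (N : ℕ) : ‖1 - e.partialProj N‖ ≤ 2 := by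
  have h1 := norm_sub_le (1 : H →L[ℂ] H) (e.partialProj N)
  have h2 := e.norm_partialProj_le N
  have h3 : ‖(1 : H →L[ℂ] H)‖ ≤ 1 := ContinuousLinearMap.norm_id_le
  linarith

theorem tendsto_one_sub_partialProj_apply (h : H) :
    Tendsto (fun N => (1 - e.partialProj N) h) atTop (𝓝 0) := by
  simpa using (e.tendsto_partialProj_apply h).const_sub h

open CompactOperators

/-- Replace x by the norm-close finite-rank operator P_M x, a sum of rank-one operators e_a ⊗ x*
e_a. Composition with 1 - P_N moves the projection onto the vectors x* e_a, where it tends to zero.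
-/
theorem tendsto_comp_one_sub_partialProj [CompleteSpace H] (x : CompactOperators H) :
    Tendsto (fun N => (x : H →L[ℂ] H) ∘L (1 - e.partialProj N)) atTop (𝓝 0) := by
  have hx := tendsto_comp_zero e.norm_one_sub_partialProj_le e.tendsto_one_sub_partialProj_apply x
  rw [Metric.tendsto_nhds] at hx ⊢
  intro ε hε
  obtain ⟨M, hM⟩ := (hx (ε / 4) (by positivity)).exists
  rw [dist_zero_right] at hM
  have h1 : ∀ a, Tendsto (fun N => rankOne ℂ (e a)
      ((x : H →L[ℂ] H).adjoint (e a)) ∘L (1 - e.partialProj N)) atTop (𝓝 0) := by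
    intro a
    have : ∀ N, ‖rankOne ℂ (e a) ((x : H →L[ℂ] H).adjoint (e a)) ∘L (1 - e.partialProj N)‖ =
        ‖(1 - e.partialProj N) ((x : H →L[ℂ] H).adjoint (e a))‖ := by
      intro N
      rw [rankOne_comp, norm_rankOne, e.orthonormal.1 a, one_mul]
      congr 2
      rw [map_sub, ← ContinuousLinearMap.star_eq_adjoint, star_one]
      simp [partialProj]
    rw [tendsto_zero_iff_norm_tendsto_zero]
    simp only [this]
    exact tendsto_zero_iff_norm_tendsto_zero.1 (e.tendsto_one_sub_partialProj_apply _)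
  have h2 : Tendsto (fun N => (e.partialProj M ∘L (x : H →L[ℂ] H)) ∘L (1 - e.partialProj N)) atTop
      (𝓝 0) := by
    have : ∀ N, (e.partialProj M ∘L (x : H →L[ℂ] H)) ∘L (1 - e.partialProj N) =
        ∑ a ∈ Finset.range M, rankOne ℂ (e a)
          ((x : H →L[ℂ] H).adjoint (e a)) ∘L (1 - e.partialProj N) := by
      intro N
      ext h
      simp only [ContinuousLinearMap.comp_apply, sum_apply, rankOne_apply,
        ContinuousLinearMap.adjoint_inner_left, partialProj_apply]
    simp only [this]
    simpa using tendsto_finsetSum (Finset.range M) fun a _ => h1 a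
  rw [Metric.tendsto_nhds] at h2
  filter_upwards [h2 (ε / 4) (by positivity)] with N hN
  rw [dist_zero_right] at hN ⊢
  calc ‖(x : H →L[ℂ] H) ∘L (1 - e.partialProj N)‖
      = ‖((1 - e.partialProj M) ∘L (x : H →L[ℂ] H)) ∘L (1 - e.partialProj N) +
        (e.partialProj M ∘L (x : H →L[ℂ] H)) ∘L (1 - e.partialProj N)‖ := by
        rw [ContinuousLinearMap.comp_assoc, ContinuousLinearMap.comp_assoc,
          ← ContinuousLinearMap.add_comp, sub_add_cancel]
        rfl
    _ ≤ ε / 4 * 2 + ε / 4 := by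
        refine (norm_add_le _ _).trans (add_le_add ?_ hN.le)
        exact (ContinuousLinearMap.opNorm_comp_le _ _).trans (mul_le_mul hM.le
          (e.norm_one_sub_partialProj_le N) (norm_nonneg _) (by positivity))
    _ < ε := by linarith

theorem tendsto_sandwich_partialProj [CompleteSpace H] (x : CompactOperators H) :
    Tendsto (fun N => sandwich (e.partialProj N) (e.partialProj N) x) atTop (𝓝 x) := by
  have h1 := tendsto_comp_zero e.norm_one_sub_partialProj_le e.tendsto_one_sub_partialProj_apply x
  have h2 := e.tendsto_comp_one_sub_partialProj x
  rw [tendsto_zero_iff_norm_tendsto_zero] at h1 h2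
  rw [tendsto_iff_norm_sub_tendsto_zero]
  have h3 := h1.add h2
  rw [add_zero] at h3
  refine squeeze_zero (fun _ => norm_nonneg _) (fun N => ?_) h3
  calc ‖sandwich (e.partialProj N) (e.partialProj N) x - x‖
      = ‖e.partialProj N ∘L (x : H →L[ℂ] H) ∘L e.partialProj N - (x : H →L[ℂ] H)‖ := rfl
    _ = ‖(1 - e.partialProj N) ∘L (x : H →L[ℂ] H) +
        e.partialProj N ∘L ((x : H →L[ℂ] H) ∘L (1 - e.partialProj N))‖ := by
        rw [← norm_neg]
        congr 1
        ext h
        simp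
    _ ≤ ‖(1 - e.partialProj N) ∘L (x : H →L[ℂ] H)‖ +
        ‖(x : H →L[ℂ] H) ∘L (1 - e.partialProj N)‖ := by
        refine (norm_add_le _ _).trans (add_le_add le_rfl ?_)
        refine (ContinuousLinearMap.opNorm_comp_le _ _).trans ?_
        exact mul_le_of_le_one_left (norm_nonneg _) (e.norm_partialProj_le N)

theorem sandwich_partialProj_eq_sum (N : ℕ) (x : CompactOperators H) :
    sandwich (e.partialProj N) (e.partialProj N) x =
      ∑ a ∈ Finset.range N, ∑ b ∈ Finset.range N,
        inner ℂ (e a) ((x : H →L[ℂ] H) (e b)) • ofRankOne (e a) (e b) := by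
  apply Subtype.ext
  ext h
  simp only [coe_sandwich, ContinuousLinearMap.comp_apply, partialProj_apply,
    AddSubmonoidClass.coe_finsetSum, Submodule.coe_smul, sum_apply, smul_apply,
    coe_ofRankOne, rankOne_apply, smul_smul, ← Finset.sum_smul]
  refine Finset.sum_congr rfl fun a _ => ?_
  simp only [map_sum, map_smul, inner_sum, inner_smul_right]
  congr 1
  exact Finset.sum_congr rfl fun b _ => mul_comm _ _

/-- The isometry permuting the basis along an injection. -/
theorem exists_linearIsometry_of_injective [CompleteSpace H] {f : ℕ → ℕ}
    (hf : Function.Injective f) : ∃ V : H →ₗᵢ[ℂ] H, ∀ a, V (e a) = e (f a) := by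
  have hv : Orthonormal ℂ fun a => e (f a) := e.orthonormal.comp f hf
  refine ⟨hv.orthogonalFamily.linearIsometry.comp e.repr.toLinearIsometry, fun a => ?_⟩
  simp [e.repr_self, OrthogonalFamily.linearIsometry_apply_single]

end HilbertBasis

/-! ### Matrix coefficients of maps on K(H) and compression to a scalar -/

namespace CompactOperators

variable {H : Type*} [NormedAddCommGroup H] [InnerProductSpace ℂ H]

theorem norm_inner_apply_le (y : CompactOperators H) (u v : H) :
    ‖inner ℂ u ((y : H →L[ℂ] H) v)‖ ≤ ‖y‖ * ‖v‖ * ‖u‖ := by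
  have h1 := norm_inner_le_norm (𝕜 := ℂ) u ((y : H →L[ℂ] H) v)
  have h2 : ‖(y : H →L[ℂ] H) v‖ ≤ ‖y‖ * ‖v‖ := (y : H →L[ℂ] H).le_opNorm v
  calc _ ≤ ‖u‖ * (‖y‖ * ‖v‖) := h1.trans (mul_le_mul_of_nonneg_left h2 (norm_nonneg _))
    _ = _ := mul_comm _ _

theorem norm_le_of_forall_inner_le {y : CompactOperators H} {C : ℝ} (hC : 0 ≤ C)
    (h : ∀ u v : H, ‖inner ℂ v ((y : H →L[ℂ] H) u)‖ ≤ C * ‖u‖ * ‖v‖) : ‖y‖ ≤ C := by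
  refine ContinuousLinearMap.opNorm_le_bound (y : H →L[ℂ] H) hC fun u => ?_
  have h1 := h u ((y : H →L[ℂ] H) u)
  rw [inner_self_eq_norm_sq_to_K, norm_pow, RCLike.norm_ofReal, abs_norm, pow_two] at h1
  rcases (norm_nonneg ((y : H →L[ℂ] H) u)).eq_or_lt with h0 | h0
  · rw [← h0]; positivity
  · exact le_of_mul_le_mul_right h1 h0

/-- The matrix coefficients of a map on compact operators with respect to matrix units. -/
noncomputable def coeff (e : HilbertBasis ℕ ℂ H) (T : CompactOperators H →L[ℂ] CompactOperators H)
    (i j k l : ℕ) : ℂ :=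
  inner ℂ (e k) ((T (ofRankOne (e i) (e j)) : H →L[ℂ] H) (e l))

section Coeff

variable (e : HilbertBasis ℕ ℂ H) (T : CompactOperators H →L[ℂ] CompactOperators H)

theorem norm_map_ofRankOne_le (x y : H) : ‖T (ofRankOne x y)‖ ≤ ‖T‖ * (‖x‖ * ‖y‖) :=
  (T.le_opNorm _).trans_eq (by rw [norm_ofRankOne])

/-- By duality it is enough to test T on (∑ a_i e_i) ⊗ e_j, whose norm is the ℓ² norm of a. -/
theorem sum_norm_sq_coeff_fst_le (j k l : ℕ) (s : Finset ℕ) :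
    ∑ i ∈ s, ‖coeff e T i j k l‖ ^ 2 ≤ ‖T‖ ^ 2 := by
  refine sum_norm_sq_le_of_forall_norm_sum_le (by positivity) fun a => ?_
  have h : ∑ i ∈ s, a i * coeff e T i j k l =
      inner ℂ (e k) ((T (ofRankOne (∑ i ∈ s, a i • e i) (e j)) : H →L[ℂ] H) (e l)) := by
    simp [ofRankOne_sum_smul_left, coeff]
  rw [h, ← e.orthonormal.norm_sum_smul_sq, ← mul_pow]
  refine pow_le_pow_left₀ (norm_nonneg _) ?_ 2
  have h1 := norm_inner_apply_le (T (ofRankOne (∑ i ∈ s, a i • e i) (e j))) (e k) (e l)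
  have h2 := norm_map_ofRankOne_le T (∑ i ∈ s, a i • e i) (e j)
  simp only [e.orthonormal.1, mul_one] at h1 h2
  exact h1.trans h2

theorem sum_norm_sq_coeff_snd_le (i k l : ℕ) (s : Finset ℕ) :
    ∑ j ∈ s, ‖coeff e T i j k l‖ ^ 2 ≤ ‖T‖ ^ 2 := by
  refine sum_norm_sq_le_of_forall_norm_sum_le (by positivity) fun a => ?_
  -- The conjugates appear because a rank-one operator is conjugate-linear in its second vector.
  have h : ∑ j ∈ s, a j * coeff e T i j k l =
      inner ℂ (e k) ((T (ofRankOne (e i) (∑ j ∈ s, (starRingEnd ℂ) (a j) • e j)) : H →L[ℂ] H)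
        (e l)) := by
    rw [ofRankOne_sum_smul_right]
    simp [coeff]
  have hn : ‖∑ j ∈ s, (starRingEnd ℂ) (a j) • e j‖ ^ 2 = ∑ j ∈ s, ‖a j‖ ^ 2 := by
    rw [e.orthonormal.norm_sum_smul_sq s fun j => (starRingEnd ℂ) (a j)]
    simp
  rw [h, ← hn, ← mul_pow]
  refine pow_le_pow_left₀ (norm_nonneg _) ?_ 2
  have h1 := norm_inner_apply_le (T (ofRankOne (e i) (∑ j ∈ s, (starRingEnd ℂ) (a j) • e j)))
    (e k) (e l)
  have h2 := norm_map_ofRankOne_le T (e i) (∑ j ∈ s, (starRingEnd ℂ) (a j) • e j)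
  simp only [e.orthonormal.1, mul_one, one_mul] at h1 h2
  exact h1.trans h2

theorem sum_norm_sq_inner_apply_left_le (x : CompactOperators H) (l : ℕ) (s : Finset ℕ) :
    ∑ k ∈ s, ‖inner ℂ (e k) ((x : H →L[ℂ] H) (e l))‖ ^ 2 ≤ ‖x‖ ^ 2 := by
  refine (e.orthonormal.sum_inner_products_le _).trans (pow_le_pow_left₀ (norm_nonneg _) ?_ 2)
  simpa [e.orthonormal.1] using (x : H →L[ℂ] H).le_opNorm (e l)

theorem sum_norm_sq_inner_apply_right_le [CompleteSpace H] (x : CompactOperators H) (k : ℕ)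
    (s : Finset ℕ) : ∑ l ∈ s, ‖inner ℂ (e k) ((x : H →L[ℂ] H) (e l))‖ ^ 2 ≤ ‖x‖ ^ 2 := by
  have : ∀ l, ‖inner ℂ (e k) ((x : H →L[ℂ] H) (e l))‖ =
      ‖inner ℂ (e l) ((x : H →L[ℂ] H).adjoint (e k))‖ := fun l => by
    rw [← ContinuousLinearMap.adjoint_inner_left, norm_inner_symm]
  simp only [this]
  refine (e.orthonormal.sum_inner_products_le _).trans (pow_le_pow_left₀ (norm_nonneg _) ?_ 2)
  have h := (x : H →L[ℂ] H).adjoint.le_opNorm (e k)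
  rw [e.orthonormal.1, mul_one, LinearIsometryEquiv.norm_map] at h
  exact h

theorem norm_sq_map_matrixUnit_le (i j : ℕ) : ‖T (ofRankOne (e i) (e j))‖ ^ 2 ≤ ‖T‖ ^ 2 := by
  have h := norm_map_ofRankOne_le T (e i) (e j)
  rw [e.orthonormal.1, e.orthonormal.1, one_mul, mul_one] at h
  exact pow_le_pow_left₀ (norm_nonneg _) h 2

theorem inner_partialProj_apply_partialProj (N : ℕ) (y : H →L[ℂ] H) (u v : H) :
    inner ℂ (e.partialProj N v) (y (e.partialProj N u)) =
      ∑ c ∈ Finset.range N, ∑ d ∈ Finset.range N,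
        inner ℂ (e c) (y (e d)) * inner ℂ (e d) u * inner ℂ v (e c) := by
  rw [e.partialProj_apply, sum_inner]
  refine Finset.sum_congr rfl fun c _ => ?_
  rw [e.partialProj_apply, map_sum, inner_sum]
  refine Finset.sum_congr rfl fun d _ => ?_
  rw [map_smul, inner_smul_left, inner_smul_right, inner_conj_symm]
  ring

/-- A map on compact operators which is close to a Schur multiplier on matrix units is close to it
on finite matrices. -/
theorem norm_inner_sub_multiplier_le [CompleteSpace H] {m : ℕ → ℕ → ℂ} {η : ℝ} (hη : 0 ≤ η)
    (he : ∀ a b c d, ‖coeff e T a b c d - if a = c ∧ b = d then m a b else 0‖ ≤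
      η * almostDiagonalBound a b c d) (N : ℕ) (x : CompactOperators H) (u v : H) :
    ‖inner ℂ (e.partialProj N v)
        ((T (sandwich (e.partialProj N) (e.partialProj N) x) : H →L[ℂ] H) (e.partialProj N u)) -
      ∑ a ∈ Finset.range N, ∑ b ∈ Finset.range N,
        m a b * inner ℂ (e a) ((x : H →L[ℂ] H) (e b)) * inner ℂ (e b) u * inner ℂ v (e a)‖ ≤
      3 * η * (‖x‖ * ‖u‖ * ‖v‖) := by
  have h1 : inner ℂ (e.partialProj N v)
      ((T (sandwich (e.partialProj N) (e.partialProj N) x) : H →L[ℂ] H) (e.partialProj N u)) =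
      ∑ a ∈ Finset.range N, ∑ b ∈ Finset.range N, ∑ c ∈ Finset.range N, ∑ d ∈ Finset.range N,
        coeff e T a b c d * inner ℂ (e a) ((x : H →L[ℂ] H) (e b)) * inner ℂ (e d) u *
          inner ℂ v (e c) := by
    have hc : ∀ c d, inner ℂ (e c)
        ((T (sandwich (e.partialProj N) (e.partialProj N) x) : H →L[ℂ] H) (e d)) =
        ∑ a ∈ Finset.range N, ∑ b ∈ Finset.range N,
          coeff e T a b c d * inner ℂ (e a) ((x : H →L[ℂ] H) (e b)) := by
      intro c d
      simp only [e.sandwich_partialProj_eq_sum, map_sum, map_smul, AddSubmonoidClass.coe_finsetSum,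
        Submodule.coe_smul, sum_apply, smul_apply, inner_sum, inner_smul_right]
      exact Finset.sum_congr rfl fun a _ => Finset.sum_congr rfl fun b _ => mul_comm _ _
    simp only [inner_partialProj_apply_partialProj, hc, Finset.sum_mul]
    rw [Finset.sum_congr rfl fun c _ => Finset.sum_comm, Finset.sum_comm]
    refine Finset.sum_congr rfl fun a _ => ?_
    rw [Finset.sum_congr rfl fun c _ => Finset.sum_comm, Finset.sum_comm]
  -- Written as a fourfold sum, the multiplier subtracts termwise and leaves only the entry errors.
  have h2 : ∑ a ∈ Finset.range N, ∑ b ∈ Finset.range N,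
        m a b * inner ℂ (e a) ((x : H →L[ℂ] H) (e b)) * inner ℂ (e b) u * inner ℂ v (e a) =
      ∑ a ∈ Finset.range N, ∑ b ∈ Finset.range N, ∑ c ∈ Finset.range N, ∑ d ∈ Finset.range N,
        (if a = c ∧ b = d then m a b else 0) * inner ℂ (e a) ((x : H →L[ℂ] H) (e b)) *
          inner ℂ (e d) u * inner ℂ v (e c) := by
    refine Finset.sum_congr rfl fun a ha => Finset.sum_congr rfl fun b hb => ?_
    simp only [ite_and, ite_mul, zero_mul, Finset.sum_ite_irrel, Finset.sum_ite_eq, if_pos ha,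
      if_pos hb, Finset.sum_const_zero]
  rw [h1, h2]
  simp only [← Finset.sum_sub_distrib, ← sub_mul]
  refine norm_sum_almostDiagonal_le he hη (norm_nonneg _) (norm_nonneg _) (norm_nonneg _)
    (fun a => sum_norm_sq_inner_apply_right_le e x a _)
    (fun b => sum_norm_sq_inner_apply_left_le e x b _)
    (e.orthonormal.sum_inner_products_le u) ?_
  simp only [norm_inner_symm v]
  exact e.orthonormal.sum_inner_products_le v

end Coeff

section Haar

variable (e : HilbertBasis ℕ ℂ H)

/-- The Haar-type matrices as compact operators. -/
noncomputable def ofHaarMatrix (n : ℕ) : CompactOperators H :=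
  ∑ a ∈ Finset.range (2 ^ n), ∑ b ∈ Finset.range (2 ^ n),
    (haarMatrix n a b : ℂ) • ofRankOne (e a) (e b)

theorem ofHaarMatrix_apply (n : ℕ) (h : H) : (ofHaarMatrix e n : H →L[ℂ] H) h =
    ∑ a ∈ Finset.range (2 ^ n),
      (∑ b ∈ Finset.range (2 ^ n), (haarMatrix n a b : ℂ) * inner ℂ (e b) h) • e a := by
  simp only [ofHaarMatrix, AddSubmonoidClass.coe_finsetSum, Submodule.coe_smul, sum_apply,
    smul_apply, coe_ofRankOne, rankOne_apply, Finset.sum_smul, smul_smul]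

theorem norm_ofHaarMatrix_le (n : ℕ) : ‖ofHaarMatrix e n‖ ≤ √n := by
  refine ContinuousLinearMap.opNorm_le_bound (ofHaarMatrix e n : H →L[ℂ] H) (Real.sqrt_nonneg _)
    fun h => ?_
  have h1 : ‖(ofHaarMatrix e n : H →L[ℂ] H) h‖ ^ 2 ≤ (√n * ‖h‖) ^ 2 := by
    rw [ofHaarMatrix_apply, e.orthonormal.norm_sum_smul_sq, mul_pow, Real.sq_sqrt (by positivity)]
    refine (sum_haarMatrix_mul_norm_sq_le n _).trans ?_
    exact mul_le_mul_of_nonneg_left (e.orthonormal.sum_inner_products_le h) (by positivity)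
  exact abs_le_of_sq_le_sq' h1 (by positivity) |>.2

theorem inner_ofHaarMatrix_apply {n a b : ℕ} (ha : a ∈ Finset.range (2 ^ n))
    (hb : b ∈ Finset.range (2 ^ n)) :
    inner ℂ (e a) ((ofHaarMatrix e n : H →L[ℂ] H) (e b)) = haarMatrix n a b := by
  rw [ofHaarMatrix_apply, e.orthonormal.inner_right_sum _ ha]
  simp only [orthonormal_iff_ite.1 e.orthonormal, mul_ite, mul_one, mul_zero, Finset.sum_ite_eq',
    if_pos hb]

end Haar

/-- Test T on the Haar matrix, of norm at most √n, against u, the sum of the first 2 ^ n basis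
vectors. As ‖u‖² = 2 ^ n, the triangular multiplier obeys the bound that forces α = β. -/
theorem triangular_limits_eq [CompleteSpace H] (e : HilbertBasis ℕ ℂ H)
    (T : CompactOperators H →L[ℂ] CompactOperators H) {α β : ℂ} {η : ℝ} (hη : 0 ≤ η)
    (he : ∀ a b c d, ‖coeff e T a b c d - if a = c ∧ b = d then (if a ≤ b then α else β) else 0‖ ≤
      η * almostDiagonalBound a b c d) : α = β := by
  refine eq_of_triangular_multiplier_bound (C := ‖T‖ + 3 * η) fun n => ?_
  set N := 2 ^ n with hN
  set u : H := ∑ a ∈ Finset.range N, (1 : ℂ) • e a with hu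
  have hinner : ∀ a ∈ Finset.range N, inner ℂ (e a) u = 1 := fun a ha =>
    e.orthonormal.inner_right_sum (fun _ => 1) ha
  have hinner' : ∀ a ∈ Finset.range N, inner ℂ u (e a) = 1 := fun a ha => by
    rw [← inner_conj_symm, hinner a ha, map_one]
  have hun : ‖u‖ * ‖u‖ = 2 ^ n := by
    rw [← pow_two, hu, e.orthonormal.norm_sum_smul_sq _ fun _ => 1]
    simp [hN]
  have key := norm_inner_sub_multiplier_le e T (m := fun a b => if a ≤ b then α else β) hη he N
    (ofHaarMatrix e n) u u
  have hsum : ∑ a ∈ Finset.range N, ∑ b ∈ Finset.range N, (if a ≤ b then α else β) *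
      inner ℂ (e a) ((ofHaarMatrix e n : H →L[ℂ] H) (e b)) * inner ℂ (e b) u * inner ℂ u (e a) =
      ∑ a ∈ Finset.range N, ∑ b ∈ Finset.range N,
        (if a ≤ b then α else β) * (haarMatrix n a b : ℂ) :=
    Finset.sum_congr rfl fun a ha => Finset.sum_congr rfl fun b hb => by
      rw [inner_ofHaarMatrix_apply e ha hb, hinner b hb, hinner' a ha, mul_one, mul_one]
  rw [hsum] at key
  have hx := norm_ofHaarMatrix_le e n
  have hpu := e.norm_partialProj_apply_le N u
  have hs : ‖sandwich (e.partialProj N) (e.partialProj N) (ofHaarMatrix e n)‖ ≤ √n := by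
    have h1 := (sandwich (e.partialProj N) (e.partialProj N)).le_opNorm (ofHaarMatrix e n)
    have h2 := norm_sandwich_le (e.partialProj N) (e.partialProj N)
    have h3 := mul_le_one₀ (e.norm_partialProj_le N) (norm_nonneg _) (e.norm_partialProj_le N)
    exact h1.trans ((mul_le_of_le_one_left (norm_nonneg _) (h2.trans h3)).trans hx)
  have hT : ‖T (sandwich (e.partialProj N) (e.partialProj N) (ofHaarMatrix e n))‖ ≤ ‖T‖ * √n :=
    (T.le_opNorm _).trans (mul_le_mul_of_nonneg_left hs (norm_nonneg _))
  have hin := norm_inner_apply_le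
    (T (sandwich (e.partialProj N) (e.partialProj N) (ofHaarMatrix e n)))
    (e.partialProj N u) (e.partialProj N u)
  have hin2 : ‖inner ℂ (e.partialProj N u)
      ((T (sandwich (e.partialProj N) (e.partialProj N) (ofHaarMatrix e n)) : H →L[ℂ] H)
        (e.partialProj N u))‖ ≤ ‖T‖ * √n * 2 ^ n := by
    refine hin.trans ?_
    calc _ ≤ ‖T‖ * √n * ‖u‖ * ‖u‖ := by gcongr
      _ = _ := by rw [mul_assoc, hun]
  have hk2 : 3 * η * (‖ofHaarMatrix e n‖ * ‖u‖ * ‖u‖) ≤ 3 * η * (√n * 2 ^ n) := by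
    rw [mul_assoc ‖_‖, hun]
    gcongr
  have tri := norm_sub_norm_le (∑ a ∈ Finset.range N, ∑ b ∈ Finset.range N,
        (if a ≤ b then α else β) * (haarMatrix n a b : ℂ)) (inner ℂ (e.partialProj N u)
      ((T (sandwich (e.partialProj N) (e.partialProj N) (ofHaarMatrix e n)) : H →L[ℂ] H)
        (e.partialProj N u)))
  rw [norm_sub_rev] at tri
  linarith

/-- The finite-section estimate is uniform in N, and P_N x P_N tends to x in norm because x is
compact. -/
theorem norm_map_sub_smul_le [CompleteSpace H] (e : HilbertBasis ℕ ℂ H)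
    (T : CompactOperators H →L[ℂ] CompactOperators H) {α : ℂ} {η : ℝ} (hη : 0 ≤ η)
    (he : ∀ a b c d, ‖coeff e T a b c d - if a = c ∧ b = d then α else 0‖ ≤
      η * almostDiagonalBound a b c d) (x : CompactOperators H) :
    ‖T x - α • x‖ ≤ 3 * η * ‖x‖ := by
  refine norm_le_of_forall_inner_le (by positivity) fun u v => ?_
  have hsum : ∀ N, ∑ a ∈ Finset.range N, ∑ b ∈ Finset.range N,
      α * inner ℂ (e a) ((x : H →L[ℂ] H) (e b)) * inner ℂ (e b) u * inner ℂ v (e a) =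
      α * inner ℂ (e.partialProj N v) ((x : H →L[ℂ] H) (e.partialProj N u)) := by
    intro N
    simp only [inner_partialProj_apply_partialProj, Finset.mul_sum, mul_assoc]
  have key := fun N => norm_inner_sub_multiplier_le e T (m := fun _ _ => α) hη he N x u v
  simp only [hsum] at key
  have hT : Tendsto (fun N => (T (sandwich (e.partialProj N) (e.partialProj N) x) : H →L[ℂ] H))
      atTop (𝓝 (T x : H →L[ℂ] H)) :=
    (continuous_subtype_val.tendsto _).comp
      ((T.continuous.tendsto _).comp (e.tendsto_sandwich_partialProj x))
  have hlim : Tendsto (fun N => inner ℂ (e.partialProj N v)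
        ((T (sandwich (e.partialProj N) (e.partialProj N) x) : H →L[ℂ] H) (e.partialProj N u)) -
      α * inner ℂ (e.partialProj N v) ((x : H →L[ℂ] H) (e.partialProj N u))) atTop
      (𝓝 (inner ℂ v ((T x : H →L[ℂ] H) u) - α * inner ℂ v ((x : H →L[ℂ] H) u))) := by
    have hu := e.tendsto_partialProj_apply u
    have hv := e.tendsto_partialProj_apply v
    have hTu := ((isBoundedBilinearMap_apply (𝕜 := ℂ) (E := H) (F := H)).continuous.tendsto
      ((T x : H →L[ℂ] H), u)).comp (hT.prodMk_nhds hu)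
    exact (hv.inner hTu).sub
      ((hv.inner (((x : H →L[ℂ] H).continuous.tendsto _).comp hu)).const_mul α)
  have hle := le_of_tendsto hlim.norm (Eventually.of_forall key)
  have e1 : inner ℂ v (((T x - α • x : CompactOperators H) : H →L[ℂ] H) u) =
      inner ℂ v ((T x : H →L[ℂ] H) u) - α * inner ℂ v ((x : H →L[ℂ] H) u) := by
    simp
  rw [e1]
  refine hle.trans_eq ?_
  ring

/-- Every bounded operator on the compact operators compresses to an operator close to a scalar. -/
theorem exists_compression_near_scalar [CompleteSpace H] (e : HilbertBasis ℕ ℂ H)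
    (T : CompactOperators H →L[ℂ] CompactOperators H) {δ : ℝ} (hδ : 0 < δ) :
    ∃ (J Q : CompactOperators H →L[ℂ] CompactOperators H) (α : ℂ), (∀ x, Q (J x) = x) ∧
      ∀ x, ‖Q (T (J x)) - α • x‖ ≤ δ * ‖x‖ := by
  -- The choice η = δ / 3 absorbs the factor 3 in `norm_map_sub_smul_le`.
  obtain ⟨I, K, α, β, hI, hK, hIK⟩ := exists_almost_triangular (t := coeff e T)
    (sum_norm_sq_coeff_fst_le e T) (sum_norm_sq_coeff_snd_le e T)
    (fun i j l s => (sum_norm_sq_inner_apply_left_le e _ l s).trans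
      (norm_sq_map_matrixUnit_le e T i j))
    (fun i j k s => (sum_norm_sq_inner_apply_right_le e _ k s).trans
      (norm_sq_map_matrixUnit_le e T i j)) (η := δ / 3) (by positivity)
  obtain ⟨V, hV⟩ := e.exists_linearIsometry_of_injective hI
  obtain ⟨W, hW⟩ := e.exists_linearIsometry_of_injective hK
  set V' := V.toContinuousLinearMap
  set W' := W.toContinuousLinearMap
  have hVV : V'.adjoint ∘L V' = 1 := V.adjoint_comp_self
  have hWW : W'.adjoint ∘L W' = 1 := W.adjoint_comp_self
  -- Conjugating T by the isometries that send e_a to e_(I a) and e_b to e_(K b) restricts its array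
  -- to the chosen rows and columns.
  have hcoeff : ∀ a b c d, coeff e (sandwich V'.adjoint W' ∘L T ∘L sandwich V' W'.adjoint) a b c d =
      coeff e T (I a) (K b) (I c) (K d) := by
    intro a b c d
    have h1 : sandwich V' W'.adjoint (ofRankOne (e a) (e b)) = ofRankOne (e (I a)) (e (K b)) := by
      apply Subtype.ext
      rw [coe_sandwich, coe_ofRankOne, coe_ofRankOne, rankOne_comp, comp_rankOne,
        ContinuousLinearMap.adjoint_adjoint, ← hV, ← hW]
      rfl
    simp only [coeff, ContinuousLinearMap.comp_apply, h1, coe_sandwich,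
      ContinuousLinearMap.adjoint_inner_right, ← hV, ← hW]
    rfl
  simp only [← hcoeff] at hIK
  obtain rfl := triangular_limits_eq e _ (by positivity) hIK
  simp only [ite_self] at hIK
  refine ⟨sandwich V' W'.adjoint, sandwich V'.adjoint W', α, fun x => ?_, fun x => ?_⟩
  · apply Subtype.ext
    calc V'.adjoint ∘L (V' ∘L (x : H →L[ℂ] H) ∘L W'.adjoint) ∘L W'
        = (V'.adjoint ∘L V') ∘L (x : H →L[ℂ] H) ∘L (W'.adjoint ∘L W') := rfl
      _ = x := by rw [hVV, hWW]; rfl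
  · have := norm_map_sub_smul_le e _ (by positivity) hIK x
    rwa [mul_div_cancel₀ _ (by norm_num)] at this

end CompactOperators

/-! ### c₀-sums and the decomposition method -/

theorem ZeroAtInftyContinuousMap.tendsto_cofinite {X : Type*} [NormedAddCommGroup X]
    (f : C₀(ℕ, X)) :
    Tendsto f cofinite (𝓝 0) := by
  have := f.zero_at_infty'
  rwa [cocompact_eq_cofinite] at this

theorem ZeroAtInftyContinuousMap.norm_apply_le {X : Type*} [NormedAddCommGroup X]
    (f : C₀(ℕ, X)) (n : ℕ) : ‖f n‖ ≤ ‖f‖ := by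
  rw [← ZeroAtInftyContinuousMap.norm_toBCF_eq_norm]
  exact f.toBCF.norm_coe_le_norm n

section Banach

variable {X : Type u} [NormedAddCommGroup X] [NormedSpace ℂ X]

/-- Pointwise convergence already gives a uniform bound, by Banach–Steinhaus. -/
theorem exists_toZeroAtInfty {W : Type*} [NormedAddCommGroup W] [NormedSpace ℂ W] [CompleteSpace W]
    (φ : ℕ → W →L[ℂ] X) (h : ∀ w, Tendsto (fun n => φ n w) cofinite (𝓝 0)) :
    ∃ Φ : W →L[ℂ] C₀(ℕ, X), ∀ w n, Φ w n = φ n w := by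
  obtain ⟨C, hC⟩ := banach_steinhaus (g := φ) fun w => by
    have hb := ((Nat.cofinite_eq_atTop ▸ h w).norm).bddAbove_range
    obtain ⟨C, hC⟩ := hb
    exact ⟨C, fun n => hC ⟨n, rfl⟩⟩
  have hC0 : 0 ≤ C := (norm_nonneg _).trans (hC 0)
  let Φ : W →ₗ[ℂ] C₀(ℕ, X) :=
    { toFun := fun w => ⟨⟨fun n => φ n w, continuous_of_discreteTopology⟩, by
        rw [cocompact_eq_cofinite]; exact h w⟩
      map_add' := fun x y => by ext n; exact map_add (φ n) x y
      map_smul' := fun c x => by ext n; exact map_smul (φ n) c x }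
  refine ⟨Φ.mkContinuous C fun w => ?_, fun w n => rfl⟩
  rw [← ZeroAtInftyContinuousMap.norm_toBCF_eq_norm]
  refine (BoundedContinuousFunction.norm_le (by positivity)).2 fun n => ?_
  exact (φ n).le_of_opNorm_le (hC n) w

/-- Evaluation on sequences tending to zero. -/
noncomputable def ZeroAtInftyContinuousMap.evalCLM (n : ℕ) : C₀(ℕ, X) →L[ℂ] X :=
  LinearMap.mkContinuous
    { toFun := fun f => f n
      map_add' := fun _ _ => rfl
      map_smul' := fun _ _ => rfl }
    1 fun f => by simpa using f.norm_apply_le n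

@[simp] theorem ZeroAtInftyContinuousMap.evalCLM_apply (n : ℕ) (f : C₀(ℕ, X)) :
    ZeroAtInftyContinuousMap.evalCLM n f = f n := rfl

open ZeroAtInftyContinuousMap in
-- Shift only the Y-coordinates: ((y₀, z₀), (y₁, z₁), …) goes to y₀ and ((y₁, z₀), (y₂, z₁), …).
theorem zeroAtInfty_equiv_prod [CompleteSpace X] {Y : Type v} [NormedAddCommGroup Y]
    [NormedSpace ℂ Y] [CompleteSpace Y] {Z : Type w} [NormedAddCommGroup Z] [NormedSpace ℂ Z]
    (e : X ≃L[ℂ] Y × Z) : Nonempty (C₀(ℕ, X) ≃L[ℂ] Y × C₀(ℕ, X)) := by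
  have hsymm : ∀ {l : Filter ℕ} {y : ℕ → Y} {z : ℕ → Z}, Tendsto y l (𝓝 0) → Tendsto z l (𝓝 0) →
      Tendsto (fun n => e.symm (y n, z n)) l (𝓝 0) := fun hy hz => by
    have := (e.symm.continuous.tendsto (0, 0)).comp (hy.prodMk_nhds hz)
    rwa [← Prod.zero_eq_mk, map_zero] at this
  have hfst : ∀ {l : Filter ℕ} {x : ℕ → X}, Tendsto x l (𝓝 0) →
      Tendsto (fun n => (e (x n)).1) l (𝓝 0) := fun hx => by
    have := ((continuous_fst.comp e.continuous).tendsto 0).comp hx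
    simpa [Function.comp_def] using this
  have hsnd : ∀ {l : Filter ℕ} {x : ℕ → X}, Tendsto x l (𝓝 0) →
      Tendsto (fun n => (e (x n)).2) l (𝓝 0) := fun hx => by
    have := ((continuous_snd.comp e.continuous).tendsto 0).comp hx
    simpa [Function.comp_def] using this
  obtain ⟨Φ, hΦ⟩ := exists_toZeroAtInfty (W := C₀(ℕ, X)) (fun n => (e.symm : Y × Z →L[ℂ] X) ∘L
    ((ContinuousLinearMap.fst ℂ Y Z ∘L (e : X →L[ℂ] Y × Z) ∘L evalCLM (n + 1)).prod
      (ContinuousLinearMap.snd ℂ Y Z ∘L (e : X →L[ℂ] Y × Z) ∘L evalCLM n))) (fun f => by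
      have hf := f.tendsto_cofinite
      rw [Nat.cofinite_eq_atTop] at hf ⊢
      exact hsymm (hfst (hf.comp (tendsto_add_atTop_nat 1))) (hsnd hf))
  obtain ⟨Ψ, hΨ⟩ := exists_toZeroAtInfty (W := Y × C₀(ℕ, X)) (fun n => (e.symm : Y × Z →L[ℂ] X) ∘L
    ((Nat.casesOn (motive := fun _ => Y × C₀(ℕ, X) →L[ℂ] Y) n
      (ContinuousLinearMap.fst ℂ Y C₀(ℕ, X)) fun k =>
      ContinuousLinearMap.fst ℂ Y Z ∘L (e : X →L[ℂ] Y × Z) ∘L evalCLM k ∘L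
        ContinuousLinearMap.snd ℂ Y C₀(ℕ, X)).prod
      (ContinuousLinearMap.snd ℂ Y Z ∘L (e : X →L[ℂ] Y × Z) ∘L evalCLM n ∘L
        ContinuousLinearMap.snd ℂ Y C₀(ℕ, X)))) (fun f => by
      have hf := f.2.tendsto_cofinite
      rw [Nat.cofinite_eq_atTop] at hf ⊢
      refine hsymm ?_ (hsnd hf)
      rw [← tendsto_add_atTop_iff_nat 1]
      exact hfst hf)
  refine ⟨ContinuousLinearEquiv.equivOfInverse
    ((ContinuousLinearMap.fst ℂ Y Z ∘L (e : X →L[ℂ] Y × Z) ∘L evalCLM 0).prod Φ) Ψ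
    (fun f => ?_) fun g => ?_⟩
  · ext n
    rw [hΨ]
    apply e.injective
    cases n <;> simp [hΦ]
  · refine Prod.ext ?_ ?_
    · simp [hΨ]
    · ext n
      apply e.injective
      simp [hΦ, hΨ]

theorem exists_zeroAtInfty_sum [CompleteSpace X] {J : ℕ → X →L[ℂ] X}
    (hJ : ∀ (s : Finset ℕ) (f : ℕ → X) (M : ℝ), 0 ≤ M → (∀ n ∈ s, ‖f n‖ ≤ M) →
      ‖∑ n ∈ s, J n (f n)‖ ≤ M) :
    ∃ E : C₀(ℕ, X) →L[ℂ] X, ∀ f, HasSum (fun n => J n (f n)) (E f) := by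
  have hs : ∀ f : C₀(ℕ, X), Summable fun n => J n (f n) := by
    intro f
    rw [summable_iff_vanishing_norm]
    intro ε hε
    have hev := f.tendsto_cofinite.norm.eventually_le_const (u := ε / 2)
      (by simpa using by positivity)
    refine ⟨hev.toFinset, fun t ht => ?_⟩
    refine (hJ t f (ε / 2) (by positivity) fun n hn => ?_).trans_lt (by linarith)
    by_contra hc
    exact Finset.disjoint_left.1 ht hn ((Set.Finite.mem_toFinset _).2 hc)
  let E : C₀(ℕ, X) →ₗ[ℂ] X :=
    { toFun := fun f => ∑' n, J n (f n)
      map_add' := fun f g => by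
        rw [← (hs f).tsum_add (hs g)]
        simp
      map_smul' := fun c f => by
        rw [RingHom.id_apply, ← (hs f).tsum_const_smul c]
        simp }
  refine ⟨E.mkContinuous 1 fun f => ?_, fun f => (hs f).hasSum⟩
  rw [one_mul]
  exact le_of_tendsto (hs f).hasSum.norm (Eventually.of_forall fun s =>
    hJ s f _ (norm_nonneg _) fun n _ => f.norm_apply_le n)

/-- A space is isomorphic to the product of a complemented copy of another one with a
complement. -/
theorem nonempty_equiv_prod_of_complemented {Y : Type v} [NormedAddCommGroup Y] [NormedSpace ℂ Y]
    {J : X →L[ℂ] Y} {Q : Y →L[ℂ] X} (h : ∀ x, Q (J x) = x) :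
    Nonempty (Y ≃L[ℂ] X × Q.ker) :=
  ⟨ContinuousLinearEquiv.equivOfRightInverse Q J h⟩

/-- X ≅ c₀(X) ⊕ W ≅ Y ⊕ c₀(X) ⊕ W ≅ Y ⊕ X, where W is the kernel of the left inverse onto c₀(X). -/
theorem nonempty_equiv_prod_self_of_zeroAtInfty [CompleteSpace X] {J Q : ℕ → X →L[ℂ] X}
    (hJ : ∀ (s : Finset ℕ) (f : ℕ → X) (M : ℝ), 0 ≤ M → (∀ n ∈ s, ‖f n‖ ≤ M) →
      ‖∑ n ∈ s, J n (f n)‖ ≤ M)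
    (hQ : ∀ x, Tendsto (fun n => Q n x) cofinite (𝓝 0))
    (hQJ : ∀ n x, Q n (J n x) = x) (hQJ' : ∀ m n x, m ≠ n → Q m (J n x) = 0)
    {Y : Type v} [NormedAddCommGroup Y]
    [NormedSpace ℂ Y] [CompleteSpace Y] {Z : Type w} [NormedAddCommGroup Z] [NormedSpace ℂ Z]
    (e : X ≃L[ℂ] Y × Z) : Nonempty (X ≃L[ℂ] Y × X) := by
  obtain ⟨E, hE⟩ := exists_zeroAtInfty_sum hJ
  obtain ⟨R, hR⟩ := exists_toZeroAtInfty Q hQ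
  have hRE : ∀ f, R (E f) = f := fun f => by
    ext n
    rw [hR]
    have h1 := (hE f).mapL (Q n)
    have h2 : HasSum (fun m => Q n (J m (f m))) (Q n (J n (f n))) :=
      hasSum_single n fun m hm => hQJ' n m _ hm.symm
    rw [h1.unique h2, hQJ]
  obtain ⟨g⟩ := nonempty_equiv_prod_of_complemented hRE
  obtain ⟨c⟩ := zeroAtInfty_equiv_prod e
  exact ⟨g.trans ((c.prodCongr (.refl ℂ _)).trans
    ((ContinuousLinearEquiv.prodAssoc ℂ _ _ _).trans
      ((ContinuousLinearEquiv.refl ℂ Y).prodCongr g.symm)))⟩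

theorem nonempty_equiv_of_complemented {Y : Type v} [NormedAddCommGroup Y] [NormedSpace ℂ Y]
    (hXX : X ≃L[ℂ] X × X) (hXY : X ≃L[ℂ] Y × X) {J : X →L[ℂ] Y} {Q : Y →L[ℂ] X}
    (h : ∀ x, Q (J x) = x) : Nonempty (X ≃L[ℂ] Y) := by
  obtain ⟨g⟩ := nonempty_equiv_prod_of_complemented h
  exact ⟨hXY.trans ((ContinuousLinearEquiv.prodComm ℂ Y X).trans
    (((ContinuousLinearEquiv.refl ℂ X).prodCongr g).trans
    ((ContinuousLinearEquiv.prodAssoc ℂ X X _).symm.trans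
    ((hXX.symm.prodCongr (.refl ℂ _)).trans g.symm))))⟩

/-- The Pełczyński decomposition method: a Banach space containing a complemented `c₀`-sum of
copies of itself is primary as soon as its identity factors through each bounded operator or its
complementary operator. -/
theorem isPrimary_of_factorization [CompleteSpace X] {J Q : ℕ → X →L[ℂ] X}
    (hJ : ∀ (s : Finset ℕ) (f : ℕ → X) (M : ℝ), 0 ≤ M → (∀ n ∈ s, ‖f n‖ ≤ M) →
      ‖∑ n ∈ s, J n (f n)‖ ≤ M)
    (hQ : ∀ x, Tendsto (fun n => Q n x) cofinite (𝓝 0))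
    (hQJ : ∀ n x, Q n (J n x) = x) (hQJ' : ∀ m n x, m ≠ n → Q m (J n x) = 0)
    (hfac : ∀ P : X →L[ℂ] X, (∃ A B : X →L[ℂ] X, ∀ x, B (P (A x)) = x) ∨
      ∃ A B : X →L[ℂ] X, ∀ x, B (A x - P (A x)) = x) :
    IsPrimary.{u, v, w} X := by
  intro Y _ _ _ Z _ _ _ ⟨e⟩
  -- The trivial splitting X ≅ X ⊕ 0 yields X ≅ X ⊕ X.
  obtain ⟨hXX⟩ := nonempty_equiv_prod_self_of_zeroAtInfty hJ hQ hQJ hQJ'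
    (ContinuousLinearEquiv.prodUnique ℂ X PUnit.{1}).symm
  have he : ∀ x, x - e.symm ((e x).1, 0) = e.symm (0, (e x).2) := fun x => by
    apply e.injective
    ext <;> simp
  rcases hfac ((e.symm : Y × Z →L[ℂ] X) ∘L ContinuousLinearMap.inl ℂ Y Z ∘L
    ContinuousLinearMap.fst ℂ Y Z ∘L (e : X →L[ℂ] Y × Z)) with ⟨A, B, h⟩ | ⟨A, B, h⟩
  · left
    obtain ⟨hXY⟩ := nonempty_equiv_prod_self_of_zeroAtInfty hJ hQ hQJ hQJ' e
    exact nonempty_equiv_of_complemented hXX hXY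
      (J := ContinuousLinearMap.fst ℂ Y Z ∘L (e : X →L[ℂ] Y × Z) ∘L A)
      (Q := B ∘L (e.symm : Y × Z →L[ℂ] X) ∘L ContinuousLinearMap.inl ℂ Y Z) h
  · right
    obtain ⟨hXZ⟩ := nonempty_equiv_prod_self_of_zeroAtInfty hJ hQ hQJ hQJ'
      (e.trans (ContinuousLinearEquiv.prodComm ℂ Y Z))
    refine nonempty_equiv_of_complemented hXX hXZ
      (J := ContinuousLinearMap.snd ℂ Y Z ∘L (e : X →L[ℂ] Y × Z) ∘L A)
      (Q := B ∘L (e.symm : Y × Z →L[ℂ] X) ∘L ContinuousLinearMap.inr ℂ Y Z) fun x => ?_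
    refine Eq.trans ?_ (h x)
    exact congrArg B (he (A x)).symm

/-- Neumann series: α⁻¹ S is at distance less than 1 from the identity. -/
theorem exists_leftInverse_of_near_scalar [CompleteSpace X] {S : X →L[ℂ] X} {α : ℂ} {δ : ℝ}
    (hδ : 0 ≤ δ) (hα : δ < ‖α‖) (h : ∀ x, ‖S x - α • x‖ ≤ δ * ‖x‖) :
    ∃ B : X →L[ℂ] X, ∀ x, B (S x) = x := by
  have hpos : 0 < ‖α‖ := hδ.trans_lt hα
  have hα0 : α ≠ 0 := norm_pos_iff.1 hpos
  have hn : ‖1 - α⁻¹ • S‖ < 1 := by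
    have hle : ‖1 - α⁻¹ • S‖ ≤ ‖α‖⁻¹ * δ := by
      refine ContinuousLinearMap.opNorm_le_bound _ (by positivity) fun x => ?_
      have e1 : (1 - α⁻¹ • S) x = -(α⁻¹ • (S x - α • x)) := by
        simp [smul_sub, smul_smul, hα0]
      rw [e1, norm_neg, norm_smul, norm_inv, mul_assoc]
      exact mul_le_mul_of_nonneg_left (h x) (by positivity)
    refine hle.trans_lt ?_
    rw [inv_mul_lt_iff₀ hpos, mul_one]
    exact hα
  obtain ⟨U, hU⟩ := isUnit_one_sub_of_norm_lt_one hn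
  rw [sub_sub_cancel] at hU
  refine ⟨α⁻¹ • (↑U⁻¹ : X →L[ℂ] X), fun x => ?_⟩
  have h1 : (↑U⁻¹ : X →L[ℂ] X) ((U : X →L[ℂ] X) x) = x := by
    rw [← mul_apply_eq_comp, Units.inv_mul]
    rfl
  rw [hU] at h1
  simpa using h1

end Banach

/-! ### Factorization of the identity and block diagonal operators -/

namespace CompactOperators

variable {H : Type u} [NormedAddCommGroup H] [InnerProductSpace ℂ H] [CompleteSpace H]

theorem identity_factors (e : HilbertBasis ℕ ℂ H)
    (P : CompactOperators H →L[ℂ] CompactOperators H) :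
    (∃ A B : CompactOperators H →L[ℂ] CompactOperators H, ∀ x, B (P (A x)) = x) ∨
      ∃ A B : CompactOperators H →L[ℂ] CompactOperators H, ∀ x, B (A x - P (A x)) = x := by
  obtain ⟨J, Q, α, hQJ, h⟩ := exists_compression_near_scalar e P (δ := 1 / 4) (by norm_num)
  have htri : 1 ≤ ‖α‖ + ‖1 - α‖ := by
    have := norm_add_le α (1 - α)
    simpa using this
  rcases le_total (1 / 2) ‖α‖ with hα | hα
  · left
    obtain ⟨B, hB⟩ := exists_leftInverse_of_near_scalar (S := Q ∘L P ∘L J) (by norm_num)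
      (by linarith) h
    exact ⟨J, B ∘L Q, hB⟩
  · right
    obtain ⟨B, hB⟩ := exists_leftInverse_of_near_scalar (S := Q ∘L (J - P ∘L J)) (α := 1 - α)
      (δ := 1 / 4) (by norm_num) (by linarith) fun x => by
        have e1 : (Q ∘L (J - P ∘L J)) x - (1 - α) • x = -(Q (P (J x)) - α • x) := by
          simp only [ContinuousLinearMap.comp_apply, sub_apply, map_sub, hQJ, sub_smul, one_smul]
          abel
        rw [e1, norm_neg]
        exact h x
    exact ⟨J, B ∘L Q, hB⟩

section BlockDiagonal

variable {V : ℕ → H →ₗᵢ[ℂ] H}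

theorem adjoint_comp_eq_zero_of_orthogonalFamily
    (hV : OrthogonalFamily ℂ (fun _ : ℕ => H) V) {m n : ℕ} (hmn : m ≠ n) :
    (V m).toContinuousLinearMap.adjoint ∘L (V n).toContinuousLinearMap = 0 := by
  ext x
  refine ext_inner_left ℂ fun y => ?_
  rw [ContinuousLinearMap.comp_apply, ContinuousLinearMap.adjoint_inner_right]
  simpa using hV hmn y x

/-- Bessel's inequality: the vector g = ∑ V_n V_n* h satisfies ⟨g, h⟩ = ‖g‖², hence ‖g‖ ≤ ‖h‖. -/
theorem sum_norm_sq_adjoint_le (hV : OrthogonalFamily ℂ (fun _ : ℕ => H) V) (s : Finset ℕ)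
    (h : H) : ∑ n ∈ s, ‖(V n).toContinuousLinearMap.adjoint h‖ ^ 2 ≤ ‖h‖ ^ 2 := by
  set g := ∑ n ∈ s, V n ((V n).toContinuousLinearMap.adjoint h) with hg
  have h1 : ‖g‖ ^ 2 = ∑ n ∈ s, ‖(V n).toContinuousLinearMap.adjoint h‖ ^ 2 := hV.norm_sum _ s
  have h2 : inner ℂ g h =
      ((∑ n ∈ s, ‖(V n).toContinuousLinearMap.adjoint h‖ ^ 2 : ℝ) : ℂ) := by
    rw [hg, sum_inner]
    push_cast
    refine Finset.sum_congr rfl fun n _ => ?_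
    have : inner ℂ (V n ((V n).toContinuousLinearMap.adjoint h)) h =
        inner ℂ ((V n).toContinuousLinearMap.adjoint h)
          ((V n).toContinuousLinearMap.adjoint h) :=
      (ContinuousLinearMap.adjoint_inner_right (V n).toContinuousLinearMap _ _).symm
    rw [this, inner_self_eq_norm_sq_to_K]
    rfl
  have h3 := norm_inner_le_norm (𝕜 := ℂ) g h
  rw [h2, ← h1, Complex.norm_real, Real.norm_of_nonneg (by positivity)] at h3
  rw [← h1]
  have h4 : ‖g‖ ≤ ‖h‖ := by
    by_contra hlt
    push Not at hlt
    nlinarith [norm_nonneg g, norm_nonneg h]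
  exact pow_le_pow_left₀ (norm_nonneg _) h4 2

/-- Blocks act between mutually orthogonal copies of H, so Pythagoras in the range and Bessel in the
domain give the supremum norm. -/
theorem norm_sum_sandwich_le (hV : OrthogonalFamily ℂ (fun _ : ℕ => H) V) (s : Finset ℕ)
    (f : ℕ → CompactOperators H) {M : ℝ} (hM : 0 ≤ M) (hf : ∀ n ∈ s, ‖f n‖ ≤ M) :
    ‖∑ n ∈ s, sandwich (V n).toContinuousLinearMap (V n).toContinuousLinearMap.adjoint (f n)‖ ≤
      M := by
  refine ContinuousLinearMap.opNorm_le_bound ((∑ n ∈ s, sandwich (V n).toContinuousLinearMap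
    (V n).toContinuousLinearMap.adjoint (f n) : CompactOperators H) : H →L[ℂ] H) hM fun h => ?_
  have e1 : ((∑ n ∈ s, sandwich (V n).toContinuousLinearMap
      (V n).toContinuousLinearMap.adjoint (f n) : CompactOperators H) : H →L[ℂ] H) h =
      ∑ n ∈ s, V n ((f n : H →L[ℂ] H) ((V n).toContinuousLinearMap.adjoint h)) := by
    rw [AddSubmonoidClass.coe_finsetSum, sum_apply]
    rfl
  have h1 : ‖∑ n ∈ s, V n ((f n : H →L[ℂ] H) ((V n).toContinuousLinearMap.adjoint h))‖ ^ 2 ≤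
      (M * ‖h‖) ^ 2 := by
    rw [hV.norm_sum (fun n => (f n : H →L[ℂ] H) ((V n).toContinuousLinearMap.adjoint h)) s,
      mul_pow]
    refine le_trans ?_ (mul_le_mul_of_nonneg_left (sum_norm_sq_adjoint_le hV s h) (by positivity))
    rw [Finset.mul_sum]
    refine Finset.sum_le_sum fun n hn => ?_
    rw [← mul_pow]
    refine pow_le_pow_left₀ (norm_nonneg _) ?_ 2
    exact (f n : H →L[ℂ] H).le_of_opNorm_le (hf n hn) _
  rw [e1]
  exact abs_le_of_sq_le_sq' h1 (by positivity) |>.2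

theorem tendsto_sandwich_adjoint (hV : OrthogonalFamily ℂ (fun _ : ℕ => H) V)
    (x : CompactOperators H) :
    Tendsto (fun n => sandwich (V n).toContinuousLinearMap.adjoint (V n).toContinuousLinearMap x)
      cofinite (𝓝 0) := by
  have hn : ∀ n, ‖(V n).toContinuousLinearMap‖ ≤ 1 := fun n => (V n).norm_toContinuousLinearMap_le
  have h1 := tendsto_comp_zero (A := fun n => (V n).toContinuousLinearMap.adjoint) (C := 1)
    (fun n => by rw [LinearIsometryEquiv.norm_map]; exact hn n)
    (fun h => tendsto_cofinite_zero_of_sum_norm_sq_le fun s => sum_norm_sq_adjoint_le hV s h) x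
  rw [tendsto_zero_iff_norm_tendsto_zero] at h1 ⊢
  refine squeeze_zero (fun _ => norm_nonneg _) (fun n => ?_) h1
  calc ‖((V n).toContinuousLinearMap.adjoint ∘L (x : H →L[ℂ] H)) ∘L (V n).toContinuousLinearMap‖
      ≤ _ := ContinuousLinearMap.opNorm_comp_le _ _
    _ ≤ _ := mul_le_of_le_one_right (norm_nonneg _) (hn n)

theorem sandwich_adjoint_sandwich (x : CompactOperators H) (A B : H →L[ℂ] H) :
    sandwich A.adjoint A (sandwich B B.adjoint x) =
      sandwich (A.adjoint ∘L B) (B.adjoint ∘L A) x := rfl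

end BlockDiagonal

end CompactOperators

theorem HilbertBasis.exists_orthogonalFamily {H : Type*} [NormedAddCommGroup H]
    [InnerProductSpace ℂ H] [CompleteSpace H] (e : HilbertBasis ℕ ℂ H) :
    ∃ V : ℕ → H →ₗᵢ[ℂ] H, OrthogonalFamily ℂ (fun _ : ℕ => H) V := by
  -- The pairing function splits ℕ into infinitely many disjoint infinite sets, one for the range of
  -- each isometry.
  have hinj : ∀ n, Function.Injective (Nat.pair n) := fun n a b h => (Nat.pair_eq_pair.1 h).2
  choose V hV using fun n => e.exists_linearIsometry_of_injective (hinj n)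
  refine ⟨V, fun m n hmn => ?_⟩
  have hzero : (V m).toContinuousLinearMap.adjoint ∘L (V n).toContinuousLinearMap = 0 := by
    refine ContinuousLinearMap.ext_on (s := Set.range e) ?_ ?_
    · rw [dense_iff_closure_eq, ← Submodule.topologicalClosure_coe, e.dense_span]
      rfl
    · rintro _ ⟨a, rfl⟩
      apply e.repr.injective
      ext b
      rw [e.repr_apply_apply, ContinuousLinearMap.comp_apply,
        ContinuousLinearMap.adjoint_inner_right]
      have : inner ℂ (V m (e b)) (V n (e a)) = 0 := by
        rw [hV, hV]
        exact e.orthonormal.2 fun h => hmn (Nat.pair_eq_pair.1 h).1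
      simpa using this
  intro x y
  have h1 := ContinuousLinearMap.adjoint_inner_right (V m).toContinuousLinearMap x (V n y)
  have h2 : (V m).toContinuousLinearMap.adjoint (V n y) = 0 := DFunLike.congr_fun hzero y
  rw [h2, inner_zero_right] at h1
  exact h1.symm

theorem corollary4 (H : Type u) [NormedAddCommGroup H] [InnerProductSpace ℂ H]
    [CompleteSpace H] [TopologicalSpace.SeparableSpace H] (hH : ¬ FiniteDimensional ℂ H) :
    IsPrimary.{u, v, w} (CompactOperators H) := by
  obtain ⟨e⟩ := exists_hilbertBasis_nat H hH
  obtain ⟨V, hV⟩ := e.exists_orthogonalFamily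
  refine isPrimary_of_factorization
    (J := fun n => CompactOperators.sandwich (V n).toContinuousLinearMap
      (V n).toContinuousLinearMap.adjoint)
    (Q := fun n => CompactOperators.sandwich (V n).toContinuousLinearMap.adjoint
      (V n).toContinuousLinearMap)
    (fun s f M hM hf => CompactOperators.norm_sum_sandwich_le hV s f hM hf)
    (CompactOperators.tendsto_sandwich_adjoint hV) (fun n x => ?_) (fun m n x hmn => ?_)
    (CompactOperators.identity_factors e)
  · rw [CompactOperators.sandwich_adjoint_sandwich, LinearIsometry.adjoint_comp_self]
    rfl
  · rw [CompactOperators.sandwich_adjoint_sandwich,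
      CompactOperators.adjoint_comp_eq_zero_of_orthogonalFamily hV hmn]
    apply Subtype.ext
    simp
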